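/- **Setting.** Let $\alpha\ge 1$ be real and let $\gamma=(\gamma_j)_{j\ge1}$ satisfy $1\ge\gamma_1\ge\gamma_2\ge\cdots>0$. For $k\in\mathbb N_0$ let $H_k(x)=\frac{(-1)^k}{\sqrt{k!}}e^{x^2/2}\frac{d^k}{dx^k}e^{-x^2/2}$, and for $\boldsymbol k\in\mathbb N_0^s$, $\boldsymbol x\in\mathbb R^s$ let $H_{\boldsymbol k}(\boldsymbol x)=\prod_{j=1}^sH_{k_j}(x_j)$. Let $\varphi_s$ be the standard normal density on $\mathbb R^s$. Put $r_{s,\alpha,\gamma}(\boldsymbol k)=\prod_{j=1}^s r_{\alpha,\gamma_j}(k_j)$, where for $\eta\in(0,1]$ $$r_{\alpha,\eta}(k)=\begin{cases}1&k=0,\\ \eta\,\frac1{k!}&1\le k<\alpha,\\ \eta\,\frac{(k-\alpha)!}{k!}&k\ge\alpha,\ k\ge 1,\end{cases}\qquad (k-\alpha)!:=\Gamma(k-\alpha+1).$$ The Gaussian ANOVA space $\mathcal H_{r_{s,\alpha,\gamma}}$ is the reproducing kernel Hilbert space of functions on $\mathbb R^s$ with kernel $K(\boldsymbol x,\boldsymbol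 y)=\sum_{\boldsymbol k\in\mathbb N_0^s}r_{s,\alpha,\gamma}(\boldsymbol k)H_{\boldsymbol k}(\boldsymbol x)H_{\boldsymbol k}(\boldsymbol y)$; its norm is written $\|\cdot\|$. For $n\in\mathbb N_0$ let $$e(n,s)=\inf_{L_i,\,g_i}\ \sup_{\|f\|\le1}\Big\|f-\sum_{i=1}^nL_i(f)\,g_i\Big\|_{L_2(\mathbb R^s,\varphi_s)},$$ where the infimum is over all continuous linear functionals $L_1,\dots,L_n$ on $\mathcal H_{r_{s,\alpha,\gamma}}$ (the information class $\Lambda^{\rm all}$) and all $g_1,\dots,g_n\in L_2(\mathbb R^s,\varphi_s)$. For $\varepsilon\in(0,1)$ and $s\in\mathbb N=\{1,2,\dots\}$ the information complexity is $n(\varepsilon,s)=\min\{n\in\mathbb N_0: e(n,s)\le\varepsilon\}$. **Notions of tractability.** In the following inequalities, $s$ ranges over $\mathbb N$ and $\varepsilon$ over $(0,1)$. * PT: there are $\tau,\sigma,C\ge0$ with $n(\varepsilon,s)\le C\varepsilon^{-\tau}s^{\sigma}$ for all $s,\varepsilon$. * SPT: there are $\tau,C\ge0$ with $n(\varepsilon,s)\le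 C\varepsilon^{-\tau}$ for all $s,\varepsilon$. The exponent of SPT is the infimum of all $\tau\ge0$ for which this holds with some $C>0$. * QPT: there are $\tau,C\ge0$ with $n(\varepsilon,s)\le C\exp(\tau(1+\ln s)(1+\ln\varepsilon^{-1}))$ for all $s,\varepsilon$. The exponent of QPT is the infimum of all $\tau\ge0$ for which this holds with some $C>0$. * WT: $\lim_{s+\varepsilon^{-1}\to\infty}\frac{\ln n(\varepsilon,s)}{s+\varepsilon^{-1}}=0$. * $(\sigma,\tau)$-WT, for $\sigma,\tau>0$: $\lim_{s+\varepsilon^{-1}\to\infty}\frac{\ln n(\varepsilon,s)}{s^\sigma+\varepsilon^{-\tau}}=0$. * UWT: $(\sigma,\tau)$-WT for all $\sigma,\tau\in(0,1]$. Let $\gamma_I=\inf_{j\ge1}\gamma_j$ and $s_\gamma=\inf\{\kappa>0:\sum_{j\ge1}\gamma_j^\kappa<\infty\}$, with $\inf\emptyset=\infty$. **Theorem.** The minimum defining $n(\varepsilon,s)$ exists for all $s\in\mathbb N$ and $\varepsilon\in(0,1)$, and: 1. SPT holds if and only if $s_\gamma<\infty$. In this case the exponent of SPT is $2\max(1/\alpha,s_\gamma)$.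 2. SPT and PT are equivalent. 3. QPT, UWT and WT are equivalent, and they hold if and only if $\gamma_I<1$. In this case the exponent of QPT is $2\max\left(\frac1\alpha,\frac1{\ln\gamma_I^{-1}}\right)$ if $\gamma_I\ne0$, and $\frac2\alpha$ if $\gamma_I=0$. 4. For all $\sigma>1$ and all $\tau>0$, $(\sigma,\tau)$-WT holds. -/

import Mathlib

open MeasureTheory ProbabilityTheory Filter Topology
open scoped ENNReal InnerProductSpace

noncomputable section

namespace HermiteTractability

/-! ### Hermite polynomials and the Gaussian measure -/

/-- The normalized `k`-th (probabilists') Hermite polynomial `H_k` as a function on `ℝ`. -/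
def hermiteFun (k : ℕ) (x : ℝ) : ℝ :=
  Polynomial.aeval x (Polynomial.hermite k) / √(k.factorial : ℝ)

/-- Rodrigues' formula: `hermiteFun` is the function
`H_k(x) = (-1)^k / √(k!) * exp(x²/2) * (d/dx)^k exp(-x²/2)`. -/
theorem hermiteFun_eq (k : ℕ) (x : ℝ) :
    hermiteFun k x = (-1 : ℝ) ^ k / √(k.factorial : ℝ) * Real.exp (x ^ 2 / 2) *
      deriv^[k] (fun y => Real.exp (-(y ^ 2 / 2))) x := by
  rw [hermiteFun, Polynomial.hermite_eq_deriv_gaussian']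
  ring

/-- The multivariate Hermite polynomial `H_k(x) = ∏_j H_{k_j}(x_j)`. -/
def hermiteMulti {s : ℕ} (k : Fin s → ℕ) (x : Fin s → ℝ) : ℝ :=
  ∏ j, hermiteFun (k j) (x j)

/-- The standard Gaussian measure `φ_s(x) dx` on `ℝ^s`. -/
abbrev gaussianMeasure (s : ℕ) : Measure (Fin s → ℝ) :=
  Measure.pi fun _ => gaussianReal 0 1

/-! ### Hermite kernels and Hermite spaces -/

/-- The Hermite kernel `K_R(x, y) = ∑_k R(k) H_k(x) H_k(y)`, in the form (a matrix of operators
on the one-dimensional space of values) in which Mathlib treats reproducing kernels. -/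
def hermiteKernel {s : ℕ} (R : (Fin s → ℕ) → ℝ) :
    Matrix (Fin s → ℝ) (Fin s → ℝ) (ℝ →L[ℝ] ℝ) :=
  Matrix.of fun x y =>
    (∑' k, R k * hermiteMulti k x * hermiteMulti k y) • ContinuousLinearMap.id ℝ ℝ

/-- The Hermite space `ℋ_R`: the reproducing kernel Hilbert space with kernel `K_R`. Its elements
are (coerced to) functions on `ℝ^s`. -/
abbrev HermiteSpace {s : ℕ} (R : (Fin s → ℕ) → ℝ) [Fact (hermiteKernel R).PosSemidef] : Type :=
  RKHS.OfKernel (hermiteKernel R)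

theorem kernel_hermiteSpace {s : ℕ} (R : (Fin s → ℕ) → ℝ) [Fact (hermiteKernel R).PosSemidef] :
    RKHS.kernel (HermiteSpace R) = hermiteKernel R :=
  RKHS.OfKernel.kernel_ofKernel

/-! ### Fourier weights of the Gaussian ANOVA space -/

/-- Sequences of product weights `1 ≥ γ_1 ≥ γ_2 ≥ ⋯ > 0`, with `γ_{j+1}` stored at index `j`. -/
structure ProductWeights where
  /-- the weights -/
  toFun : ℕ → ℝ
  pos : ∀ j, 0 < toFun j
  le_one : ∀ j, toFun j ≤ 1
  antitone : Antitone toFun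

instance : CoeFun ProductWeights fun _ => ℕ → ℝ := ⟨ProductWeights.toFun⟩

/-- The univariate Fourier weight `r_{α,γ}(k)`, where `(k - α)!` is read as `Γ(k - α + 1)`. -/
def anovaWeight₁ (α γ : ℝ) (k : ℕ) : ℝ :=
  if k = 0 then 1
  else if (k : ℝ) < α then γ * (1 / (k.factorial : ℝ))
  else γ * (Real.Gamma ((k : ℝ) - α + 1) / (k.factorial : ℝ))

/-- The Fourier weight `r_{s,α,γ}(k) = ∏_{j=1}^s r_{α,γ_j}(k_j)`. -/
def anovaWeight (α : ℝ) (γ : ℕ → ℝ) (s : ℕ) (k : Fin s → ℕ) : ℝ :=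
  ∏ j : Fin s, anovaWeight₁ α (γ j) (k j)

/-! ### Positive semidefiniteness of the kernel of the Gaussian ANOVA space -/

section Kernel

theorem posSemidef_hermiteKernel {s : ℕ} (R : (Fin s → ℕ) → ℝ) (hR : ∀ k, 0 ≤ R k)
    (hsum : ∀ x, Summable fun k => R k * hermiteMulti k x ^ 2) :
    (hermiteKernel R).PosSemidef := by
  have hsum2 : ∀ x y, Summable fun k => R k * hermiteMulti k x * hermiteMulti k y := by
    intro x y
    refine Summable.of_norm_bounded (((hsum x).add (hsum y))) fun k => ?_
    rw [Real.norm_eq_abs, mul_assoc, abs_mul, abs_of_nonneg (hR k), ← mul_add]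
    refine mul_le_mul_of_nonneg_left ?_ (hR k)
    rw [abs_le]
    constructor <;> nlinarith [sq_nonneg (hermiteMulti k x + hermiteMulti k y),
      sq_nonneg (hermiteMulti k x - hermiteMulti k y), sq_nonneg (hermiteMulti k x),
      sq_nonneg (hermiteMulti k y)]
  refine (List.TFAE.out (RKHS.posSemidef_tfae (K := hermiteKernel R)) 0 2).mpr
    (And.intro ?_ fun vv => ?_)
  · ext x y
    simp only [hermiteKernel, Matrix.conjTranspose_apply, Matrix.of_apply, star_smul, star_trivial]
    have hid : star (ContinuousLinearMap.id ℝ ℝ) = ContinuousLinearMap.id ℝ ℝ :=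
      star_one (ℝ →L[ℝ] ℝ)
    rw [hid]
    simp [mul_right_comm]
  · have key : (vv.sum fun x w => vv.sum fun x' w' => ⟪hermiteKernel R x' x w, w'⟫_ℝ)
        = ∑' k, R k * (∑ x ∈ vv.support, vv x * hermiteMulti k x) ^ 2 := by
      have h1 : ∀ k, R k * (∑ x ∈ vv.support, vv x * hermiteMulti k x) ^ 2
          = ∑ x ∈ vv.support, ∑ x' ∈ vv.support,
            (vv x * vv x') * (R k * hermiteMulti k x' * hermiteMulti k x) := by
        intro k
        rw [sq, Finset.sum_mul_sum, Finset.mul_sum]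
        refine Finset.sum_congr rfl fun x _ => ?_
        rw [Finset.mul_sum]
        refine Finset.sum_congr rfl fun x' _ => ?_
        ring
      simp_rw [h1]
      rw [Summable.tsum_finsetSum fun x _ => summable_sum fun x' _ => (hsum2 x' x).mul_left _]
      simp only [Finsupp.sum]
      refine Finset.sum_congr rfl fun x _ => ?_
      rw [Summable.tsum_finsetSum fun x' _ => (hsum2 x' x).mul_left _]
      refine Finset.sum_congr rfl fun x' _ => ?_
      rw [tsum_mul_left]
      simp [hermiteKernel]
      ring
    rw [key]
    exact tsum_nonneg fun k => mul_nonneg (hR k) (sq_nonneg _)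

theorem summable_prod_of_summable {s : ℕ} (a : Fin s → ℕ → ℝ) (h0 : ∀ j k, 0 ≤ a j k)
    (hs : ∀ j, Summable (a j)) : Summable fun k : Fin s → ℕ => ∏ j, a j (k j) := by
  classical
  refine summable_of_sum_le (c := ∏ j, ∑' k, a j k)
    (fun k => Finset.prod_nonneg fun j _ => h0 j _) fun S => ?_
  have hS : S ⊆ Fintype.piFinset fun j => S.image fun k => k j := by
    intro k hk
    rw [Fintype.mem_piFinset]
    exact fun j => Finset.mem_image_of_mem _ hk
  calc ∑ k ∈ S, ∏ j, a j (k j)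
      ≤ ∑ k ∈ Fintype.piFinset (fun j => S.image fun k => k j), ∏ j, a j (k j) :=
        Finset.sum_le_sum_of_subset_of_nonneg hS
          fun k _ _ => Finset.prod_nonneg fun j _ => h0 j _
    _ = ∏ j, ∑ i ∈ S.image (fun k => k j), a j i := (Finset.prod_univ_sum _ _).symm
    _ ≤ ∏ j, ∑' i, a j i := Finset.prod_le_prod
        (fun j _ => Finset.sum_nonneg fun i _ => h0 j i)
        fun j _ => (hs j).sum_le_tsum _ fun i _ => h0 j i

theorem anovaWeight₁_nonneg {α γ : ℝ} (hγ : 0 ≤ γ) (k : ℕ) : 0 ≤ anovaWeight₁ α γ k := by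
  unfold anovaWeight₁
  split_ifs with h1 h2
  · exact zero_le_one
  · positivity
  · refine mul_nonneg hγ (div_nonneg (Real.Gamma_nonneg_of_nonneg ?_) (by positivity))
    linarith [not_lt.mp h2]

theorem anovaWeight₁_le {α γ : ℝ} (hα : 1 ≤ α) (hγ1 : γ ≤ 1) (k : ℕ) :
    anovaWeight₁ α γ (k + 1) ≤ 1 / ((k : ℝ) + 1) := by
  have hk : (0 : ℝ) < (k.factorial : ℝ) := by positivity
  have hk1 : (1 : ℝ) ≤ (k.factorial : ℝ) := by
    exact_mod_cast Nat.one_le_iff_ne_zero.mpr k.factorial_ne_zero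
  have hf : ((k + 1).factorial : ℝ) = ((k : ℝ) + 1) * k.factorial := by
    rw [Nat.factorial_succ]; push_cast; ring
  have main : ∀ t : ℝ, 0 ≤ t → t ≤ k.factorial →
      γ * (t / ((k + 1).factorial : ℝ)) ≤ 1 / ((k : ℝ) + 1) := by
    intro t ht0 ht
    have h1 : t / ((k + 1).factorial : ℝ) ≤ 1 / ((k : ℝ) + 1) := by
      rw [hf, div_le_div_iff₀ (by positivity) (by positivity)]
      nlinarith [(Nat.cast_nonneg k : (0 : ℝ) ≤ k)]
    have h0 : 0 ≤ t / ((k + 1).factorial : ℝ) := by positivity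
    nlinarith
  unfold anovaWeight₁
  rw [if_neg (Nat.succ_ne_zero k)]
  split_ifs with h2
  · exact main 1 zero_le_one hk1
  · have h2' := not_lt.mp h2
    push_cast at h2' ⊢
    refine main _ (Real.Gamma_nonneg_of_nonneg (by linarith)) ?_
    have hmem : (k : ℝ) + 1 - α + 1 ∈ segment ℝ (1 : ℝ) ((k : ℝ) + 1) := by
      rw [segment_eq_Icc (by linarith [(Nat.cast_nonneg k : (0 : ℝ) ≤ k)])]
      constructor <;> linarith
    have := Real.convexOn_Gamma.le_max_of_mem_segment (x := 1) (y := (k : ℝ) + 1)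
      (by simp) (by simp only [Set.mem_Ioi]; positivity) hmem
    rw [Real.Gamma_one, Real.Gamma_nat_eq_factorial] at this
    exact this.trans (max_le hk1 le_rfl)

/-- The Gaussian weight without its normalization. -/
def gw (x : ℝ) : ℝ := Real.exp (-(x ^ 2 / 2))

theorem integrable_poly_gw (p : Polynomial ℝ) : Integrable fun x => p.eval x * gw x := by
  induction p using Polynomial.induction_on' with
  | add p q hp hq => exact (hp.add hq).congr (Filter.Eventually.of_forall fun x => by simp [add_mul])
  | monomial n a =>
    have h := integrable_rpow_mul_exp_neg_mul_sq (b := 1 / 2) (by norm_num) (s := (n : ℝ))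
      (lt_of_lt_of_le (by norm_num) (Nat.cast_nonneg n))
    have h2 := h.const_mul a
    refine h2.congr (Filter.Eventually.of_forall fun x => ?_)
    simp only [Real.rpow_natCast, Polynomial.eval_monomial, gw]
    rw [show -(1 / 2 : ℝ) * x ^ 2 = -(x ^ 2 / 2) by ring]
    ring

/-- The Hermite polynomials with real coefficients. -/
def hermR (n : ℕ) : Polynomial ℝ := (Polynomial.hermite n).map (Int.castRingHom ℝ)

theorem hermR_eval (n : ℕ) (x : ℝ) :
    (hermR n).eval x = Polynomial.aeval x (Polynomial.hermite n) := by
  rw [hermR, Polynomial.eval_map, Polynomial.aeval_def]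
  rfl

theorem hermR_succ (n : ℕ) :
    hermR (n + 1) = Polynomial.X * hermR n - Polynomial.derivative (hermR n) := by
  simp [hermR, Polynomial.hermite_succ, Polynomial.derivative_map]

theorem hasDerivAt_hermR_gw (n : ℕ) (x : ℝ) :
    HasDerivAt (fun x => -((hermR n).eval x * gw x)) ((hermR (n + 1)).eval x * gw x) x := by
  have h1 : HasDerivAt gw (gw x * (-x)) x := by
    have : HasDerivAt (fun x : ℝ => -(x ^ 2 / 2)) (-x) x := by
      have := ((hasDerivAt_pow 2 x).div_const 2).neg
      exact this.congr_deriv (by simp)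
    exact this.exp
  have h2 := (((hermR n).hasDerivAt x).mul h1).neg
  refine h2.congr_deriv ?_
  rw [hermR_succ]
  simp
  ring

theorem integral_poly_hermR_succ (p : Polynomial ℝ) (n : ℕ) :
    ∫ x, p.eval x * ((hermR (n + 1)).eval x * gw x)
      = ∫ x, (Polynomial.derivative p).eval x * ((hermR n).eval x * gw x) := by
  have hi : ∀ q r : Polynomial ℝ, Integrable fun x => q.eval x * (r.eval x * gw x) := by
    intro q r
    simpa [mul_assoc] using integrable_poly_gw (q * r)
  have := integral_mul_deriv_eq_deriv_mul_of_integrable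
    (u := fun x => p.eval x) (v := fun x => -((hermR n).eval x * gw x))
    (fun x _ => p.hasDerivAt x) (fun x _ => hasDerivAt_hermR_gw n x) (hi p _)
    (by simpa [Pi.mul_def] using (hi (Polynomial.derivative p) (hermR n)).neg)
    (by simpa [Pi.mul_def] using (hi p (hermR n)).neg)
  rw [this, ← integral_neg]
  congr 1
  ext x
  ring

theorem integral_poly_hermR (p : Polynomial ℝ) (n : ℕ) :
    ∫ x, p.eval x * ((hermR n).eval x * gw x)
      = ∫ x, (Polynomial.derivative^[n] p).eval x * gw x := by
  induction n generalizing p with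
  | zero => simp [hermR]
  | succ n ih => rw [integral_poly_hermR_succ, ih, Function.iterate_succ_apply]

theorem hermR_natDegree (n : ℕ) : (hermR n).natDegree = n := by
  rw [hermR, (Polynomial.hermite_monic n).natDegree_map, Polynomial.natDegree_hermite]

theorem integral_gw : ∫ x, gw x = √(2 * Real.pi) := by
  have := integral_gaussian (1 / 2)
  rw [show Real.pi / (1 / 2) = 2 * Real.pi by ring] at this
  rw [← this]
  congr 1
  ext x
  rw [gw]
  congr 1
  ring

theorem integral_hermR_lt {m n : ℕ} (h : m < n) :
    ∫ x, (hermR m).eval x * ((hermR n).eval x * gw x) = 0 := by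
  rw [integral_poly_hermR, Polynomial.iterate_derivative_eq_zero (by rwa [hermR_natDegree])]
  simp

theorem integral_hermR_self (n : ℕ) :
    ∫ x, (hermR n).eval x * ((hermR n).eval x * gw x) = n.factorial * √(2 * Real.pi) := by
  have h : Polynomial.derivative^[n] (hermR n) = Polynomial.C (n.factorial : ℝ) := by
    have hd : (Polynomial.derivative^[n] (hermR n)).natDegree = 0 := by
      have := Polynomial.natDegree_iterate_derivative (hermR n) n
      rw [hermR_natDegree] at this
      omega
    rw [Polynomial.eq_C_of_natDegree_eq_zero hd, Polynomial.coeff_iterate_derivative]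
    have : (hermR n).coeff n = 1 := by
      simp [hermR]
    simp [this, Nat.descFactorial_self]
  rw [integral_poly_hermR, h]
  simp only [Polynomial.eval_C]
  rw [integral_const_mul, integral_gw]

theorem integral_hermiteFun_mul (m n : ℕ) :
    ∫ x, hermiteFun m x * hermiteFun n x * gw x = if m = n then √(2 * Real.pi) else 0 := by
  have h : ∀ x, hermiteFun m x * hermiteFun n x * gw x
      = (√(m.factorial : ℝ) * √(n.factorial : ℝ))⁻¹ *
        ((hermR m).eval x * ((hermR n).eval x * gw x)) := by
    intro x
    simp only [hermiteFun, hermR_eval]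
    field_simp
  simp_rw [h]
  rw [integral_const_mul]
  split_ifs with hmn
  · subst hmn
    rw [integral_hermR_self, Real.mul_self_sqrt (by positivity)]
    field_simp
  · rcases lt_or_gt_of_ne hmn with h' | h'
    · rw [integral_hermR_lt h', mul_zero]
    · have : ∀ x, (hermR m).eval x * ((hermR n).eval x * gw x)
          = (hermR n).eval x * ((hermR m).eval x * gw x) := fun x => by ring
      simp_rw [this]
      rw [integral_hermR_lt h', mul_zero]

theorem integrable_hermiteFun_mul (m n : ℕ) :
    Integrable fun x => hermiteFun m x * hermiteFun n x * gw x := by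
  have h := (integrable_poly_gw (hermR m * hermR n)).const_mul
    (√(m.factorial : ℝ) * √(n.factorial : ℝ))⁻¹
  refine h.congr (Filter.Eventually.of_forall fun x => ?_)
  simp only [hermiteFun, ← hermR_eval, Polynomial.eval_mul]
  field_simp

theorem integrable_hermiteFun_gw (n : ℕ) : Integrable fun x => hermiteFun n x * gw x := by
  simpa [hermiteFun, hermR] using integrable_hermiteFun_mul 0 n

theorem setIntegral_hermiteFun_succ (n : ℕ) (x : ℝ) :
    ∫ y in Set.Iic x, hermiteFun (n + 1) y * gw y
      = -(hermiteFun n x * gw x) / √((n : ℝ) + 1) := by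
  have hint := fun k => integrable_poly_gw (hermR k)
  have ht : Tendsto (fun x => -((hermR n).eval x * gw x)) atBot (𝓝 0) :=
    tendsto_zero_of_hasDerivAt_of_integrableOn_Iic (a := x)
      (fun y _ => hasDerivAt_hermR_gw n y) (hint (n + 1)).integrableOn
      (hint n).neg.integrableOn
  have h := integral_Iic_of_hasDerivAt_of_tendsto' (a := x)
    (fun y _ => hasDerivAt_hermR_gw n y) (hint (n + 1)).integrableOn ht
  have h2 : ∀ y, hermiteFun (n + 1) y * gw y
      = (√((n + 1).factorial : ℝ))⁻¹ * ((hermR (n + 1)).eval y * gw y) := by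
    intro y
    rw [hermR_eval, hermiteFun]
    ring
  simp_rw [h2]
  rw [integral_const_mul, h, hermR_eval, hermiteFun, Nat.factorial_succ]
  push_cast
  rw [Real.sqrt_mul (by positivity)]
  field_simp
  ring

/-- Bessel's inequality for the indicator function of a half-line. -/
theorem summable_hermiteFun_sq (x : ℝ) : Summable fun n : ℕ => hermiteFun n x ^ 2 / ((n : ℝ) + 1) := by
  set D := √(2 * Real.pi) with hD
  have hDpos : 0 < D := by positivity
  set c : ℕ → ℝ := fun n => ∫ y in Set.Iic x, hermiteFun n y * gw y with hc
  have hgw : ∀ y, 0 ≤ gw y := fun y => (Real.exp_pos _).le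
  have hgwi : Integrable gw := by simpa using integrable_poly_gw 1
  have bessel : ∀ S : Finset ℕ, ∑ n ∈ S, c n ^ 2 ≤ D * D := by
    intro S
    set g : ℝ → ℝ := fun y => ∑ n ∈ S, c n * hermiteFun n y with hg
    have hggi : Integrable fun y => g y * g y * gw y := by
      have : (fun y => g y * g y * gw y) = fun y => ∑ m ∈ S, ∑ n ∈ S,
          c m * c n * (hermiteFun m y * hermiteFun n y * gw y) := by
        ext y
        simp only [hg]
        rw [Finset.sum_mul_sum, Finset.sum_mul]
        refine Finset.sum_congr rfl fun m _ => ?_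
        rw [Finset.sum_mul]
        exact Finset.sum_congr rfl fun n _ => by ring
      rw [this]
      exact integrable_finsetSum _ fun m _ => integrable_finsetSum _ fun n _ =>
        (integrable_hermiteFun_mul m n).const_mul _
    have hgg : ∫ y, g y * g y * gw y = D * ∑ n ∈ S, c n ^ 2 := by
      have : (fun y => g y * g y * gw y) = fun y => ∑ m ∈ S, ∑ n ∈ S,
          c m * c n * (hermiteFun m y * hermiteFun n y * gw y) := by
        ext y
        simp only [hg]
        rw [Finset.sum_mul_sum, Finset.sum_mul]
        refine Finset.sum_congr rfl fun m _ => ?_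
        rw [Finset.sum_mul]
        exact Finset.sum_congr rfl fun n _ => by ring
      rw [this, integral_finsetSum _ fun m _ => integrable_finsetSum _ fun n _ =>
        (integrable_hermiteFun_mul m n).const_mul _, Finset.mul_sum]
      refine Finset.sum_congr rfl fun m hm => ?_
      rw [integral_finsetSum _ fun n _ => (integrable_hermiteFun_mul m n).const_mul _]
      simp_rw [integral_const_mul, integral_hermiteFun_mul]
      simp [hm, hD]
      ring
    have hgi : Integrable fun y => g y * gw y := by
      have : (fun y => g y * gw y) = fun y => ∑ n ∈ S, c n * (hermiteFun n y * gw y) := by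
        ext y
        simp only [hg, Finset.sum_mul, mul_assoc]
      rw [this]
      exact integrable_finsetSum _ fun n _ => (integrable_hermiteFun_gw n).const_mul _
    have h1g : ∫ y in Set.Iic x, g y * gw y = ∑ n ∈ S, c n ^ 2 := by
      have : (fun y => g y * gw y) = fun y => ∑ n ∈ S, c n * (hermiteFun n y * gw y) := by
        ext y
        simp only [hg, Finset.sum_mul, mul_assoc]
      rw [this, integral_finsetSum _ fun n _ =>
        ((integrable_hermiteFun_gw n).const_mul _).integrableOn]
      refine Finset.sum_congr rfl fun n _ => ?_
      rw [integral_const_mul, sq]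
    have h0 : ∀ y ∈ Set.Iic x, 0 ≤ D * gw y - 2 * (g y * gw y) + D⁻¹ * (g y * g y * gw y) := by
      intro y _
      have : D * gw y - 2 * (g y * gw y) + D⁻¹ * (g y * g y * gw y)
          = D⁻¹ * (D - g y) ^ 2 * gw y := by
        field_simp
        ring
      rw [this]
      have := hgw y
      positivity
    have h3 := setIntegral_nonneg (μ := volume) measurableSet_Iic h0
    have h3' : ∫ y in Set.Iic x, (D * gw y - 2 * (g y * gw y) + D⁻¹ * (g y * g y * gw y))
        = D * (∫ y in Set.Iic x, gw y) - 2 * (∑ n ∈ S, c n ^ 2)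
          + D⁻¹ * ∫ y in Set.Iic x, g y * g y * gw y := by
      have i1 : IntegrableOn (fun y => D * gw y - 2 * (g y * gw y)) (Set.Iic x) :=
        ((hgwi.const_mul D).sub (hgi.const_mul 2)).integrableOn
      rw [integral_add i1 (hggi.const_mul _).integrableOn,
        integral_sub (hgwi.const_mul _).integrableOn (hgi.const_mul _).integrableOn,
        integral_const_mul, integral_const_mul, integral_const_mul, h1g]
    rw [h3'] at h3
    have h4 : ∫ y in Set.Iic x, gw y ≤ D := by
      rw [hD, ← integral_gw]
      exact setIntegral_le_integral hgwi (Filter.Eventually.of_forall hgw)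
    have h5 : ∫ y in Set.Iic x, g y * g y * gw y ≤ D * ∑ n ∈ S, c n ^ 2 := by
      rw [← hgg]
      exact setIntegral_le_integral hggi
        (Filter.Eventually.of_forall fun y => mul_nonneg (mul_self_nonneg _) (hgw y))
    have h6 : D⁻¹ * ∫ y in Set.Iic x, g y * g y * gw y ≤ ∑ n ∈ S, c n ^ 2 := by
      rw [inv_mul_le_iff₀ hDpos]
      exact h5
    have h7 := mul_le_mul_of_nonneg_left h4 hDpos.le
    linarith
  have hs : Summable fun n => c n ^ 2 := summable_of_sum_le (fun n => sq_nonneg _) bessel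
  have hs1 := (summable_nat_add_iff 1).mpr hs
  have hx : gw x ≠ 0 := (Real.exp_pos _).ne'
  refine (hs1.mul_left ((gw x)⁻¹ ^ 2)).congr fun n => ?_
  have hn : (0 : ℝ) < (n : ℝ) + 1 := by positivity
  simp only [hc]
  rw [setIntegral_hermiteFun_succ, div_pow, Real.sq_sqrt hn.le]
  field_simp

/-- The series defining the kernel of the Gaussian ANOVA space converges. -/
theorem summable_anovaWeight_mul_sq {α : ℝ} (hα : 1 ≤ α) (γ : ProductWeights) (s : ℕ)
    (x : Fin s → ℝ) : Summable fun k => anovaWeight α γ s k * hermiteMulti k x ^ 2 := by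
  have h := summable_prod_of_summable
    (fun (j : Fin s) k => anovaWeight₁ α (γ j) k * hermiteFun k (x j) ^ 2)
    (fun j k => mul_nonneg (anovaWeight₁_nonneg (γ.pos j).le k) (sq_nonneg _)) fun j => by
      rw [← summable_nat_add_iff 1]
      have h1 := (summable_nat_add_iff 1).mpr (summable_hermiteFun_sq (x j))
      refine Summable.of_nonneg_of_le
        (fun k => mul_nonneg (anovaWeight₁_nonneg (γ.pos j).le _) (sq_nonneg _)) (fun k => ?_)
        (h1.mul_left 2)
      have h2 := anovaWeight₁_le hα (γ.le_one j) k
      have h3 : 1 / ((k : ℝ) + 1) ≤ 2 / (((k + 1 : ℕ) : ℝ) + 1) := by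
        push_cast
        rw [div_le_div_iff₀ (by positivity) (by positivity)]
        linarith [(Nat.cast_nonneg k : (0 : ℝ) ≤ k)]
      calc anovaWeight₁ α (γ j) (k + 1) * hermiteFun (k + 1) (x j) ^ 2
          ≤ 2 / (((k + 1 : ℕ) : ℝ) + 1) * hermiteFun (k + 1) (x j) ^ 2 :=
            mul_le_mul_of_nonneg_right (h2.trans h3) (sq_nonneg _)
        _ = 2 * (hermiteFun (k + 1) (x j) ^ 2 / (((k + 1 : ℕ) : ℝ) + 1)) := by ring
  refine h.congr fun k => ?_
  simp only [anovaWeight, hermiteMulti]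
  rw [← Finset.prod_pow, Finset.prod_mul_distrib]

instance posSemidef_anovaKernel {α : ℝ} [hα : Fact (1 ≤ α)] (γ : ProductWeights) (s : ℕ) :
    Fact (hermiteKernel (anovaWeight α γ s)).PosSemidef :=
  ⟨posSemidef_hermiteKernel _
    (fun _ => Finset.prod_nonneg fun j _ => anovaWeight₁_nonneg (γ.pos j).le _)
    (summable_anovaWeight_mul_sq hα.out γ s)⟩

end Kernel

/-! ### `L₂`-approximation with arbitrary linear information -/

section Approximation

variable {s : ℕ} (R : (Fin s → ℕ) → ℝ) [Fact (hermiteKernel R).PosSemidef]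

/-- The worst-case error
`sup_{‖f‖_R ≤ 1} ‖f - ∑_{i=1}^n L_i(f) g_i‖_{L₂(ℝ^s, φ_s)}` of the linear algorithm
`A(f) = ∑_{i=1}^n L_i(f) g_i`. -/
def worstCaseError {n : ℕ} (L : Fin n → StrongDual ℝ (HermiteSpace R))
    (g : Fin n → Lp ℝ 2 (gaussianMeasure s)) : ℝ≥0∞ :=
  ⨆ (f : HermiteSpace R) (_ : ‖f‖ ≤ 1),
    eLpNorm (fun x => f x - ∑ i, L i f * g i x) 2 (gaussianMeasure s)

/-- The `n`-th minimal worst-case error `e(n, APP_R; Λ^all)`: the infimum over all algorithms that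
use `n` arbitrary continuous linear functionals. -/
def minimalError (n : ℕ) : ℝ≥0∞ :=
  ⨅ (L : Fin n → StrongDual ℝ (HermiteSpace R)) (g : Fin n → Lp ℝ 2 (gaussianMeasure s)),
    worstCaseError R L g

/-- The information complexity `n(ε, APP_R; Λ^all) = min {n : e(n, APP_R; Λ^all) ≤ ε}`. -/
def infoComplexity (ε : ℝ) : ℕ :=
  sInf {n : ℕ | minimalError R n ≤ ENNReal.ofReal ε}

end Approximation

/-! ### Notions of tractability, for an information complexity `n ε s` -/

section Tractability

variable (n : ℝ → ℕ → ℕ)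

/-- Polynomial tractability. -/
def PT : Prop := ∃ τ σ C : ℝ, 0 ≤ τ ∧ 0 ≤ σ ∧ 0 ≤ C ∧
  ∀ s : ℕ, 1 ≤ s → ∀ ε ∈ Set.Ioo (0 : ℝ) 1, (n ε s : ℝ) ≤ C * ε ^ (-τ) * (s : ℝ) ^ σ

/-- Strong polynomial tractability. -/
def SPT : Prop := ∃ τ C : ℝ, 0 ≤ τ ∧ 0 ≤ C ∧
  ∀ s : ℕ, 1 ≤ s → ∀ ε ∈ Set.Ioo (0 : ℝ) 1, (n ε s : ℝ) ≤ C * ε ^ (-τ)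

/-- The exponent of strong polynomial tractability. -/
def sptExponent : ℝ := sInf {τ : ℝ | 0 ≤ τ ∧ ∃ C : ℝ, 0 < C ∧
  ∀ s : ℕ, 1 ≤ s → ∀ ε ∈ Set.Ioo (0 : ℝ) 1, (n ε s : ℝ) ≤ C * ε ^ (-τ)}

/-- Quasi-polynomial tractability. -/
def QPT : Prop := ∃ τ C : ℝ, 0 ≤ τ ∧ 0 ≤ C ∧
  ∀ s : ℕ, 1 ≤ s → ∀ ε ∈ Set.Ioo (0 : ℝ) 1,
    (n ε s : ℝ) ≤ C * Real.exp (τ * (1 + Real.log s) * (1 + Real.log ε⁻¹))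

/-- The exponent of quasi-polynomial tractability. -/
def qptExponent : ℝ := sInf {τ : ℝ | 0 ≤ τ ∧ ∃ C : ℝ, 0 < C ∧
  ∀ s : ℕ, 1 ≤ s → ∀ ε ∈ Set.Ioo (0 : ℝ) 1,
    (n ε s : ℝ) ≤ C * Real.exp (τ * (1 + Real.log s) * (1 + Real.log ε⁻¹))}

/-- The limit process `s + ε⁻¹ → ∞` for pairs `(ε, s)` with `s ≥ 1` and `ε ∈ (0, 1)`. -/
def limitFilter : Filter (ℝ × ℕ) :=
  comap (fun p : ℝ × ℕ => (p.2 : ℝ) + p.1⁻¹) atTop ⊓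
    𝓟 {p : ℝ × ℕ | p.1 ∈ Set.Ioo (0 : ℝ) 1 ∧ 1 ≤ p.2}

/-- `(σ, τ)`-weak tractability. -/
def WeakTractability (σ τ : ℝ) : Prop :=
  Tendsto (fun p : ℝ × ℕ => Real.log (n p.1 p.2) / ((p.2 : ℝ) ^ σ + p.1 ^ (-τ)))
    limitFilter (𝓝 0)

/-- Weak tractability. -/
def WT : Prop :=
  Tendsto (fun p : ℝ × ℕ => Real.log (n p.1 p.2) / ((p.2 : ℝ) + p.1⁻¹)) limitFilter (𝓝 0)

/-- Uniform weak tractability. -/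
def UWT : Prop :=
  ∀ σ ∈ Set.Ioc (0 : ℝ) 1, ∀ τ ∈ Set.Ioc (0 : ℝ) 1, WeakTractability n σ τ

end Tractability

/-! ### Figures of the weight sequence -/

/-- The sum exponent `s_γ = inf {κ > 0 : ∑_j γ_j^κ < ∞}`, with `inf ∅ = ∞`. -/
def sumExponent (γ : ProductWeights) : ℝ≥0∞ :=
  ⨅ (κ : ℝ) (_ : 0 < κ) (_ : Summable fun j => γ j ^ κ), ENNReal.ofReal κ

/-- The infimum `γ_I` of the weights. -/
def weightInf (γ : ProductWeights) : ℝ := ⨅ j, γ j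

/-- The information complexity of `L₂`-approximation for the Gaussian ANOVA space
`ℋ_{r_{s,α,γ}}` and the information class `Λ^all`, as a function of `ε` and `s`. -/
def anovaComplexity (α : ℝ) [Fact (1 ≤ α)] (γ : ProductWeights) (ε : ℝ) (s : ℕ) : ℕ :=
  infoComplexity (anovaWeight α γ s) ε

end HermiteTractability

end

open HermiteTractability

/-!
The singular numbers of the embedding of the space with weights `R` into `L₂` are `√(R k)`, so the
information complexity at `ε` counts the indices `k` with `ε² < R k`. Markov's inequality for the
`κ`-th power bounds that number by `ε^(-2κ) ∏ (1 + γ_j^κ ζ(κ))`, with `ζ(κ)` finite exactly when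
`1 / α < κ`: a fixed `κ` above the sum exponent gives strong polynomial tractability, and `κ`
growing like `1 + ln s` gives quasi-polynomial tractability as soon as `inf γ < 1`. For the lower
bounds, one coordinate alone forces the exponent `2 / α`, because its weights decay like `k^(-α)`,
and the indicators of the `m`-subsets of the first `s` coordinates are `(s choose m)` indices of
weight at least `γ_s^m`.
-/

namespace HermiteTractability

open Asymptotics

/-! ### Orthonormal functions and reproducing kernels -/

section OrthonormalFunctions

variable {X ι : Type*} {mX : MeasurableSpace X} {μ : Measure X}

theorem ae_eq_of_hasSum_Lp [Countable ι] {E : Type*} [NormedAddCommGroup E] {p : ℝ≥0∞}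
    [Fact (1 ≤ p)] {f : ι → Lp E p μ} {g : Lp E p μ} {F : X → E} (hg : HasSum f g)
    (hF : ∀ᵐ x ∂μ, HasSum (fun k => f k x) (F x)) : g =ᵐ[μ] F := by
  obtain ⟨S, hS, hSg⟩ := (tendstoInMeasure_of_tendsto_Lp hg).exists_seq_tendsto_ae'
  have hsum : ∀ᵐ x ∂μ, ∀ n, (∑ k ∈ S n, f k : Lp E p μ) x = ∑ k ∈ S n, f k x :=
    ae_all_iff.mpr fun n => Lp.coeFn_fun_finsetSum (S n) f
  filter_upwards [hSg, hsum, hF] with x hxg hxsum hxF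
  simp only [hxsum] at hxg
  exact tendsto_nhds_unique hxg (hxF.comp hS)

/-- A family of real functions that are orthonormal in `L₂(μ)`, as functions rather than as
elements of the quotient space `Lp ℝ 2 μ`. -/
structure IsL2Orthonormal (e : ι → X → ℝ) (μ : Measure X) : Prop where
  memLp : ∀ k, MemLp (e k) 2 μ
  orthonormal : Orthonormal ℝ fun k => (memLp k).toLp

theorem isL2Orthonormal_of_integral [DecidableEq ι] {e : ι → X → ℝ} (he : ∀ k, MemLp (e k) 2 μ)
    (h : ∀ k l, ∫ x, e k x * e l x ∂μ = if k = l then 1 else 0) : IsL2Orthonormal e μ where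
  memLp := he
  orthonormal := by
    refine orthonormal_iff_ite.mpr fun k l => ?_
    rw [L2.inner_def, ← h k l]
    refine integral_congr_ae ?_
    filter_upwards [(he k).coeFn_toLp, (he l).coeFn_toLp] with x hk hl
    simp [hk, hl, mul_comm]

theorem memℓp_two_of_summable_sq {a : ι → ℝ} (ha : Summable fun k => a k ^ 2) :
    Memℓp (E := fun _ : ι => ℝ) a 2 :=
  memℓp_gen (by simpa using ha)

theorem summable_sq (w : lp (fun _ : ι => ℝ) 2) : Summable fun k => w k ^ 2 := by
  simpa [sq] using lp.summable_inner (𝕜 := ℝ) w w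

theorem norm_sq_eq_tsum (w : lp (fun _ : ι => ℝ) 2) : ‖w‖ ^ 2 = ∑' k, w k ^ 2 := by
  simpa using lp.norm_rpow_eq_tsum (p := 2) (by simp) w

theorem IsL2Orthonormal.eLpNorm_of_hasSum [Countable ι] {e : ι → X → ℝ}
    (he : IsL2Orthonormal e μ) {a : ι → ℝ} {F : X → ℝ} (ha : Summable fun k => a k ^ 2)
    (hF : ∀ x, HasSum (fun k => a k * e k x) (F x)) :
    eLpNorm F 2 μ = ENNReal.ofReal √(∑' k, a k ^ 2) := by
  let w : lp (fun _ : ι => ℝ) 2 := ⟨a, memℓp_two_of_summable_sq ha⟩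
  let G := he.orthonormal.orthogonalFamily.linearIsometry w
  have hG : HasSum (fun k => a k • (he.memLp k).toLp) G :=
    he.orthonormal.orthogonalFamily.hasSum_linearIsometry w
  have hterm : ∀ᵐ x ∂μ, ∀ k, (a k • (he.memLp k).toLp : Lp ℝ 2 μ) x = a k * e k x := by
    refine ae_all_iff.mpr fun k => ?_
    filter_upwards [Lp.coeFn_smul (a k) (he.memLp k).toLp, (he.memLp k).coeFn_toLp] with x h₁ h₂
    simp [h₁, h₂]
  have hGF : G =ᵐ[μ] F := by
    refine ae_eq_of_hasSum_Lp hG ?_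
    filter_upwards [hterm] with x hx
    simpa only [hx] using hF x
  calc eLpNorm F 2 μ = ENNReal.ofReal ‖G‖ := by
        rw [← eLpNorm_congr_ae hGF, ofReal_norm, Lp.enorm_def]
    _ = ENNReal.ofReal √(∑' k, a k ^ 2) := by
        rw [LinearIsometry.norm_map, ← Real.sqrt_sq (norm_nonneg w), norm_sq_eq_tsum]

theorem IsL2Orthonormal.eq_zero_of_hasSum_zero [Countable ι] {e : ι → X → ℝ}
    (he : IsL2Orthonormal e μ) {a : ι → ℝ} (ha : Summable fun k => a k ^ 2)
    (h0 : ∀ x, HasSum (fun k => a k * e k x) 0) : a = 0 := by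
  have hzero : ∑' k, a k ^ 2 = 0 := by
    have h := he.eLpNorm_of_hasSum (F := 0) ha h0
    rw [eLpNorm_zero, eq_comm, ENNReal.ofReal_eq_zero] at h
    exact (Real.sqrt_eq_zero'.mp (h.antisymm (Real.sqrt_nonneg _))).antisymm
      (tsum_nonneg fun k => sq_nonneg (a k))
  have ha0 := (hasSum_zero_iff_of_nonneg fun k => sq_nonneg (a k)).mp (hzero ▸ ha.hasSum)
  exact funext fun k => pow_eq_zero_iff two_ne_zero |>.mp (congrFun ha0 k)

end OrthonormalFunctions

section Feature

variable {X ι : Type*}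

theorem denseRange_linearCombination_iff {E : Type*} [AddCommGroup E] [Module ℝ E]
    [TopologicalSpace E] {φ : X → E} :
    DenseRange (Finsupp.linearCombination ℝ φ) ↔
      Dense (Submodule.span ℝ (Set.range φ) : Set E) := by
  rw [DenseRange, ← LinearMap.coe_range, Finsupp.range_linearCombination]

theorem exists_linearIsometryEquiv_of_inner_eq {E F : Type*} [NormedAddCommGroup E]
    [InnerProductSpace ℝ E] [CompleteSpace E] [NormedAddCommGroup F] [InnerProductSpace ℝ F]
    [CompleteSpace F] {φ : X → E} {ψ : X → F}
    (hφ : Dense (Submodule.span ℝ (Set.range φ) : Set E))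
    (hψ : Dense (Submodule.span ℝ (Set.range ψ) : Set F))
    (h : ∀ x y, ⟪ψ x, ψ y⟫_ℝ = ⟪φ x, φ y⟫_ℝ) :
    ∃ V : E ≃ₗᵢ[ℝ] F, ∀ x, V (φ x) = ψ x := by
  have hnorm : ∀ a : X →₀ ℝ,
      ‖Finsupp.linearCombination ℝ ψ a‖ = ‖Finsupp.linearCombination ℝ φ a‖ := fun a => by
    simp only [← sq_eq_sq₀ (norm_nonneg _) (norm_nonneg _), ← real_inner_self_eq_norm_sq,
      Finsupp.linearCombination_apply, Finsupp.sum, sum_inner, inner_sum, real_inner_smul_left,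
      real_inner_smul_right, h]
  refine ⟨(LinearEquiv.refl ℝ (X →₀ ℝ)).extendOfIsometry _ _
    (denseRange_linearCombination_iff.mpr hφ) (denseRange_linearCombination_iff.mpr hψ) hnorm,
    fun x => ?_⟩
  have hx := LinearEquiv.extendOfIsometry_eq (LinearEquiv.refl ℝ (X →₀ ℝ)) _ _
    (denseRange_linearCombination_iff.mpr hφ) (denseRange_linearCombination_iff.mpr hψ) hnorm
    (Finsupp.single x 1)
  simpa using hx

variable (H : Type*) [NormedAddCommGroup H] [InnerProductSpace ℝ H] [CompleteSpace H]
  [RKHS ℝ H X ℝ]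

theorem dense_span_kerFun_one :
    Dense (Submodule.span ℝ (Set.range fun x => RKHS.kerFun H x 1) : Set H) := by
  have hdense : Dense (Submodule.span ℝ {RKHS.kerFun H x v | (x) (v)} : Set H) := by
    rw [Submodule.dense_iff_topologicalClosure_eq_top, RKHS.kerFun_dense]
  refine hdense.mono (SetLike.coe_subset_coe.mpr (Submodule.span_le.mpr ?_))
  rintro _ ⟨x, v, rfl⟩
  have hv : RKHS.kerFun H x v = v • RKHS.kerFun H x 1 := by simp [← map_smul]
  exact hv ▸ Submodule.smul_mem _ v (Submodule.subset_span ⟨x, rfl⟩)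

variable {H}

theorem exists_hilbertBasis_of_kernel_eq_tsum {φ : ι → X → ℝ}
    (hφ : ∀ x, Summable fun k => φ k x ^ 2)
    (hker : ∀ x y, RKHS.kernel H x y 1 = ∑' k, φ k x * φ k y)
    (hindep : ∀ w : lp (fun _ : ι => ℝ) 2, (∀ x, HasSum (fun k => w k * φ k x) 0) → w = 0) :
    ∃ b : HilbertBasis ι ℝ H, ∀ k, ⇑(b k) = φ k := by
  classical
  let ψ : X → lp (fun _ : ι => ℝ) 2 := fun x => ⟨fun k => φ k x, memℓp_two_of_summable_sq (hφ x)⟩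
  have hψw : ∀ x w, HasSum (fun k => w k * φ k x) ⟪ψ x, w⟫_ℝ := fun x w => by
    simpa [ψ] using lp.hasSum_inner (𝕜 := ℝ) (ψ x) w
  have hgram : ∀ x y, ⟪ψ x, ψ y⟫_ℝ = ⟪RKHS.kerFun H x 1, RKHS.kerFun H y 1⟫_ℝ := fun x y => by
    rw [← (hψw x (ψ y)).tsum_eq, ← RKHS.kernel_inner, hker]
    simp [ψ, mul_comm]
  have hdense : Dense (Submodule.span ℝ (Set.range ψ) : Set (lp (fun _ : ι => ℝ) 2)) := by
    rw [Submodule.dense_iff_topologicalClosure_eq_top,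
      Submodule.topologicalClosure_eq_top_iff, Submodule.eq_bot_iff]
    refine fun w hw => hindep w fun x => ?_
    have hxw : ⟪ψ x, w⟫_ℝ = 0 := hw _ (Submodule.subset_span ⟨x, rfl⟩)
    exact hxw ▸ hψw x w
  obtain ⟨V, hV⟩ := exists_linearIsometryEquiv_of_inner_eq (dense_span_kerFun_one H) hdense hgram
  refine ⟨.ofRepr V, fun k => funext fun x => ?_⟩
  calc V.symm (lp.single 2 k 1) x = ⟪RKHS.kerFun H x 1, V.symm (lp.single 2 k 1)⟫_ℝ := by
        simp [RKHS.kerFun_inner]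
    _ = ⟪ψ x, lp.single 2 k 1⟫_ℝ := by rw [← V.inner_map_map, V.apply_symm_apply, hV]
    _ = φ k x := by simp [lp.inner_single_right, ψ]

end Feature

/-! ### The minimal error -/

theorem exists_mem_norm_eq_one_of_lt_finrank {E : Type*} [NormedAddCommGroup E]
    [NormedSpace ℝ E] {p : Submodule ℝ E} {n : ℕ}
    (hn : n < Module.finrank ℝ p) (L : Fin n → StrongDual ℝ E) :
    ∃ f ∈ p, ‖f‖ = 1 ∧ ∀ i, L i f = 0 := by
  have : FiniteDimensional ℝ p := Module.finite_of_finrank_pos (by omega)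
  let ℓ : p →ₗ[ℝ] Fin n → ℝ := LinearMap.pi fun i => (L i).toLinearMap ∘ₗ p.subtype
  have hker : ℓ.ker ≠ ⊥ := LinearMap.ker_ne_bot_of_finrank_lt (by simpa using hn)
  obtain ⟨v, hv, hv0⟩ := (Submodule.ne_bot_iff _).mp hker
  refine ⟨‖(v : E)‖⁻¹ • v, p.smul_mem _ v.2, norm_smul_inv_norm (by simpa using hv0), fun i => ?_⟩
  have hi : L i v = 0 := congrFun (LinearMap.mem_ker.mp hv) i
  rw [map_smul, hi, smul_zero]

section HilbertBasisSpan

variable {ι E : Type*} [NormedAddCommGroup E] [InnerProductSpace ℝ E] (b : HilbertBasis ι ℝ E)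

theorem finrank_span_image_eq_card (T : Finset ι) :
    Module.finrank ℝ (Submodule.span ℝ (b '' T)) = T.card := by
  have h := finrank_span_eq_card
    (b.orthonormal.linearIndependent.comp ((↑) : T → ι) Subtype.val_injective)
  rw [Set.image_eq_range]
  simpa [Function.comp_def] using h

theorem repr_eq_zero_of_mem_span_image {T : Set ι} {f : E} (hf : f ∈ Submodule.span ℝ (b '' T))
    {k : ι} (hk : k ∉ T) : b.repr f k = 0 := by
  have hspan : Submodule.span ℝ (b '' T) ≤ (innerₛₗ ℝ (b k)).ker := by
    rw [Submodule.span_le]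
    rintro _ ⟨l, hl, rfl⟩
    exact b.orthonormal.2 fun h => hk (h ▸ hl)
  exact (b.repr_apply_apply f k).trans (hspan hf)

theorem repr_sub_sum_repr_smul [DecidableEq ι] (S : Finset ι) (f : E) (k : ι) :
    b.repr (f - ∑ l ∈ S, b.repr f l • b l) k = if k ∈ S then 0 else b.repr f k := by
  simp only [b.repr_apply_apply, inner_sub_right, inner_sum, inner_smul_right,
    orthonormal_iff_ite.mp b.orthonormal, mul_ite, mul_one, mul_zero, Finset.sum_ite_eq]
  split_ifs <;> simp

end HilbertBasisSpan

section MercerBasis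

variable {X ι : Type*} {mX : MeasurableSpace X} {μ : Measure X} {e : ι → X → ℝ} {R : ι → ℝ}
  {H : Type*} [NormedAddCommGroup H] [InnerProductSpace ℝ H] [RKHS ℝ H X ℝ]

theorem summable_mul_sq_of_bddAbove (hR : ∀ k, 0 ≤ R k) (hbdd : BddAbove (Set.range R))
    (w : lp (fun _ : ι => ℝ) 2) : Summable fun k => R k * w k ^ 2 := by
  obtain ⟨M, hM⟩ := hbdd
  exact ((summable_sq w).mul_left M).of_nonneg_of_le
    (fun k => mul_nonneg (hR k) (sq_nonneg _))
    fun k => mul_le_mul_of_nonneg_right (hM ⟨k, rfl⟩) (sq_nonneg _)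

theorem exists_hilbertBasis_sqrt_mul [CompleteSpace H] [Countable ι] (he : IsL2Orthonormal e μ)
    (hR : ∀ k, 0 < R k) (hbdd : BddAbove (Set.range R))
    (hsum : ∀ x, Summable fun k => R k * e k x ^ 2)
    (hker : ∀ x y, RKHS.kernel H x y 1 = ∑' k, R k * e k x * e k y) :
    ∃ b : HilbertBasis ι ℝ H, ∀ k, ⇑(b k) = fun x => √(R k) * e k x := by
  have hsq : ∀ k (t : ℝ), (√(R k) * t) ^ 2 = R k * t ^ 2 := fun k t => by
    rw [mul_pow, Real.sq_sqrt (hR k).le]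
  refine exists_hilbertBasis_of_kernel_eq_tsum (fun x => by simpa only [hsq] using hsum x)
    (fun x y => (hker x y).trans (tsum_congr fun k => ?_)) fun w hw => ?_
  · rw [mul_mul_mul_comm, Real.mul_self_sqrt (hR k).le, mul_assoc]
  · have hcoeff : (fun k => √(R k) * w k) = 0 := by
      refine he.eq_zero_of_hasSum_zero ?_ fun x => (hw x).congr_fun fun k => ?_
      · simpa only [hsq] using summable_mul_sq_of_bddAbove (fun k => (hR k).le) hbdd w
      · ring
    ext k
    exact (mul_eq_zero.mp (congrFun hcoeff k)).resolve_left (Real.sqrt_pos.mpr (hR k)).ne'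

variable {b : HilbertBasis ι ℝ H} (hb : ∀ k, ⇑(b k) = fun x => √(R k) * e k x)
include hb

theorem hasSum_repr_apply (f : H) (x : X) :
    HasSum (fun k => √(R k) * b.repr f k * e k x) (f x) := by
  have h := (b.hasSum_repr f).mapL (.proj x ∘L RKHS.coeCLM ℝ)
  refine h.congr_fun fun k => ?_
  simp only [ContinuousLinearMap.comp_apply, map_smul, RKHS.coeCLM_apply,
    ContinuousLinearMap.proj_apply, hb, smul_eq_mul]
  ring

theorem sum_repr_smul_apply (S : Finset ι) (f : H) (x : X) :
    (∑ k ∈ S, b.repr f k • b k : H) x = ∑ k ∈ S, √(R k) * b.repr f k * e k x := by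
  rw [← RKHS.coeCLM_apply (𝕜 := ℝ), map_sum, Finset.sum_apply]
  refine Finset.sum_congr rfl fun k _ => ?_
  simp only [map_smul, Pi.smul_apply, RKHS.coeCLM_apply, hb, smul_eq_mul]
  ring

variable [Countable ι] (he : IsL2Orthonormal e μ) (hR : ∀ k, 0 ≤ R k)
  (hbdd : BddAbove (Set.range R))
include he hR hbdd

theorem eLpNorm_eq_sqrt_tsum_repr (f : H) :
    eLpNorm f 2 μ = ENNReal.ofReal √(∑' k, R k * b.repr f k ^ 2) := by
  have hsq : ∀ k, (√(R k) * b.repr f k) ^ 2 = R k * b.repr f k ^ 2 := fun k => by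
    rw [mul_pow, Real.sq_sqrt (hR k)]
  simpa only [hsq] using he.eLpNorm_of_hasSum
    (by simpa only [hsq] using summable_mul_sq_of_bddAbove hR hbdd (b.repr f))
    (hasSum_repr_apply hb f)

theorem eLpNorm_le_of_repr_sq_le {m : ℝ} {f g : H}
    (h : ∀ k, R k * b.repr f k ^ 2 ≤ m * b.repr g k ^ 2) :
    eLpNorm f 2 μ ≤ ENNReal.ofReal √(m * ‖g‖ ^ 2) := by
  rw [eLpNorm_eq_sqrt_tsum_repr hb he hR hbdd, ← b.repr.norm_map g, norm_sq_eq_tsum,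
    ← tsum_mul_left]
  refine ENNReal.ofReal_le_ofReal (Real.sqrt_le_sqrt ?_)
  exact (summable_mul_sq_of_bddAbove hR hbdd _).tsum_le_tsum h ((summable_sq _).mul_left m)

theorem le_eLpNorm_of_le_repr_sq {m : ℝ} {f : H}
    (h : ∀ k, m * b.repr f k ^ 2 ≤ R k * b.repr f k ^ 2) :
    ENNReal.ofReal √(m * ‖f‖ ^ 2) ≤ eLpNorm f 2 μ := by
  rw [eLpNorm_eq_sqrt_tsum_repr hb he hR hbdd, ← b.repr.norm_map f, norm_sq_eq_tsum,
    ← tsum_mul_left]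
  refine ENNReal.ofReal_le_ofReal (Real.sqrt_le_sqrt ?_)
  exact ((summable_sq _).mul_left m).tsum_le_tsum h (summable_mul_sq_of_bddAbove hR hbdd _)

theorem exists_eLpNorm_sub_sum_le (S : Finset ι) {ε : ℝ} (hε : 0 ≤ ε)
    (hS : ∀ k ∉ S, R k ≤ ε ^ 2) :
    ∃ (L : Fin S.card → StrongDual ℝ H) (g : Fin S.card → Lp ℝ 2 μ), ∀ f : H, ‖f‖ ≤ 1 →
      eLpNorm (fun x => f x - ∑ i, L i f * g i x) 2 μ ≤ ENNReal.ofReal ε := by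
  classical
  let k : Fin S.card ≃ S := S.equivFin.symm
  refine ⟨fun i => √(R (k i)) • innerSL ℝ (b (k i)), fun i => (he.memLp (k i)).toLp, fun f hf => ?_⟩
  let r : H := f - ∑ k ∈ S, b.repr f k • b k
  have hr : (fun x => f x - ∑ i, (√(R (k i)) • innerSL ℝ (b (k i))) f
      * (he.memLp (k i)).toLp (e (k i)) x) =ᵐ[μ] r := by
    have htoLp : ∀ᵐ x ∂μ, ∀ i, (he.memLp (k i)).toLp (e (k i)) x = e (k i) x :=
      ae_all_iff.mpr fun i => (he.memLp (k i)).coeFn_toLp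
    filter_upwards [htoLp] with x hx
    rw [RKHS.coe_sub, Pi.sub_apply, sum_repr_smul_apply hb, ← Finset.sum_coe_sort S, ← k.sum_comp]
    simp [hx, b.repr_apply_apply]
  rw [eLpNorm_congr_ae hr]
  refine (eLpNorm_le_of_repr_sq_le hb he hR hbdd (m := ε ^ 2) (g := f) fun k => ?_).trans ?_
  · rw [repr_sub_sum_repr_smul]
    split_ifs with hk
    · simp [mul_nonneg, sq_nonneg]
    · exact mul_le_mul_of_nonneg_right (hS k hk) (sq_nonneg _)
  · rw [← mul_pow, Real.sqrt_sq (by positivity)]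
    exact ENNReal.ofReal_le_ofReal (mul_le_of_le_one_right hε hf)

theorem exists_le_eLpNorm_sub_sum (T : Finset ι) {m : ℝ} (hT : ∀ k ∈ T, m ≤ R k) {n : ℕ}
    (hn : n < T.card) (L : Fin n → StrongDual ℝ H) (g : Fin n → X → ℝ) :
    ∃ f : H, ‖f‖ ≤ 1 ∧
      ENNReal.ofReal √m ≤ eLpNorm (fun x => f x - ∑ i, L i f * g i x) 2 μ := by
  classical
  obtain ⟨f, hf, hf1, hLf⟩ := exists_mem_norm_eq_one_of_lt_finrank
    (hn.trans_eq (finrank_span_image_eq_card b T).symm) L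
  refine ⟨f, hf1.le, ?_⟩
  have h := le_eLpNorm_of_le_repr_sq hb he hR hbdd (f := f) (m := m) fun k => by
    by_cases hk : k ∈ T
    · exact mul_le_mul_of_nonneg_right (hT k hk) (sq_nonneg _)
    · simp [repr_eq_zero_of_mem_span_image b hf (by simpa using hk)]
  simpa [hLf, hf1] using h

end MercerBasis

section Hermite

theorem continuous_hermiteFun (k : ℕ) : Continuous (hermiteFun k) := by
  unfold hermiteFun
  fun_prop

theorem continuous_hermiteMulti {s : ℕ} (k : Fin s → ℕ) : Continuous (hermiteMulti k) :=
  continuous_finsetProd _ fun j _ => (continuous_hermiteFun (k j)).comp (continuous_apply j)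

theorem gaussianPDFReal_zero_one (x : ℝ) :
    gaussianPDFReal 0 1 x = (√(2 * Real.pi))⁻¹ * gw x := by
  simp [gaussianPDFReal_def, gw, neg_div]

theorem integrable_hermiteFun_mul_gaussianReal (m n : ℕ) :
    Integrable (fun x => hermiteFun m x * hermiteFun n x) (gaussianReal 0 1) := by
  rw [gaussianReal_of_var_ne_zero _ one_ne_zero, integrable_withDensity_iff_integrable_smul'
    (measurable_gaussianPDF 0 1) (Eventually.of_forall fun x => gaussianPDF_lt_top)]
  refine ((integrable_hermiteFun_mul m n).const_mul (√(2 * Real.pi))⁻¹).congr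
    (Eventually.of_forall fun x => ?_)
  simp only [toReal_gaussianPDF, gaussianPDFReal_zero_one, smul_eq_mul]
  ring

theorem integral_hermiteFun_mul_gaussianReal (m n : ℕ) :
    ∫ x, hermiteFun m x * hermiteFun n x ∂(gaussianReal 0 1) = if m = n then 1 else 0 := by
  have hpdf : ∀ x, gaussianPDFReal 0 1 x • (hermiteFun m x * hermiteFun n x)
      = (√(2 * Real.pi))⁻¹ * (hermiteFun m x * hermiteFun n x * gw x) := fun x => by
    rw [gaussianPDFReal_zero_one, smul_eq_mul]
    ring
  simp only [integral_gaussianReal_eq_integral_smul one_ne_zero, hpdf, integral_const_mul,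
    integral_hermiteFun_mul, mul_ite, mul_zero]
  rw [inv_mul_cancel₀ (by positivity)]

theorem integrable_hermiteMulti_mul {s : ℕ} (k l : Fin s → ℕ) :
    Integrable (fun x => hermiteMulti k x * hermiteMulti l x) (gaussianMeasure s) := by
  simp only [hermiteMulti, ← Finset.prod_mul_distrib]
  exact Integrable.fintype_prod (f := fun j x => hermiteFun (k j) x * hermiteFun (l j) x)
    fun j => integrable_hermiteFun_mul_gaussianReal _ _

theorem integral_hermiteMulti_mul {s : ℕ} (k l : Fin s → ℕ) :
    ∫ x, hermiteMulti k x * hermiteMulti l x ∂(gaussianMeasure s) = if k = l then 1 else 0 := by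
  simp only [hermiteMulti, ← Finset.prod_mul_distrib]
  rw [integral_fintype_prod_eq_prod (fun j x => hermiteFun (k j) x * hermiteFun (l j) x)]
  simp_rw [integral_hermiteFun_mul_gaussianReal, Finset.prod_ite_zero, funext_iff]
  simp

theorem isL2Orthonormal_hermiteMulti (s : ℕ) :
    IsL2Orthonormal (hermiteMulti : (Fin s → ℕ) → (Fin s → ℝ) → ℝ) (gaussianMeasure s) := by
  refine isL2Orthonormal_of_integral (fun k => ?_) integral_hermiteMulti_mul
  rw [memLp_two_iff_integrable_sq (continuous_hermiteMulti k).aestronglyMeasurable]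
  simpa only [sq] using integrable_hermiteMulti_mul k k

variable {s : ℕ} {R : (Fin s → ℕ) → ℝ} [Fact (hermiteKernel R).PosSemidef]

theorem exists_hilbertBasis_hermiteSpace (hR : ∀ k, 0 < R k) (hbdd : BddAbove (Set.range R))
    (hsum : ∀ x, Summable fun k => R k * hermiteMulti k x ^ 2) :
    ∃ b : HilbertBasis (Fin s → ℕ) ℝ (HermiteSpace R),
      ∀ k, ⇑(b k) = fun x => √(R k) * hermiteMulti k x :=
  exists_hilbertBasis_sqrt_mul (isL2Orthonormal_hermiteMulti s) hR hbdd hsum fun x y => by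
    rw [kernel_hermiteSpace]
    simp [hermiteKernel]

theorem minimalError_card_le (hR : ∀ k, 0 < R k) (hbdd : BddAbove (Set.range R))
    (hsum : ∀ x, Summable fun k => R k * hermiteMulti k x ^ 2) (S : Finset (Fin s → ℕ)) {ε : ℝ}
    (hε : 0 ≤ ε) (hS : ∀ k ∉ S, R k ≤ ε ^ 2) :
    minimalError R S.card ≤ ENNReal.ofReal ε := by
  obtain ⟨b, hb⟩ := exists_hilbertBasis_hermiteSpace hR hbdd hsum
  obtain ⟨L, g, hLg⟩ := exists_eLpNorm_sub_sum_le hb (isL2Orthonormal_hermiteMulti s)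
    (fun k => (hR k).le) hbdd S hε hS
  exact iInf₂_le_of_le L g (iSup₂_le hLg)

theorem ofReal_sqrt_le_minimalError (hR : ∀ k, 0 < R k) (hbdd : BddAbove (Set.range R))
    (hsum : ∀ x, Summable fun k => R k * hermiteMulti k x ^ 2) (T : Finset (Fin s → ℕ)) {m : ℝ}
    (hT : ∀ k ∈ T, m ≤ R k) {n : ℕ} (hn : n < T.card) :
    ENNReal.ofReal √m ≤ minimalError R n := by
  obtain ⟨b, hb⟩ := exists_hilbertBasis_hermiteSpace hR hbdd hsum
  refine le_iInf₂ fun L g => ?_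
  obtain ⟨f, hf, hfm⟩ := exists_le_eLpNorm_sub_sum hb (isL2Orthonormal_hermiteMulti s)
    (fun k => (hR k).le) hbdd T hT hn L fun i => g i
  exact le_iSup₂_of_le f hf hfm

theorem infoComplexity_eq_ncard (hR : ∀ k, 0 < R k) (hbdd : BddAbove (Set.range R))
    (hsum : ∀ x, Summable fun k => R k * hermiteMulti k x ^ 2) {ε : ℝ} (hε : 0 < ε)
    (hfin : {k | ε ^ 2 < R k}.Finite) :
    infoComplexity R ε = {k | ε ^ 2 < R k}.ncard := by
  have hupper : minimalError R hfin.toFinset.card ≤ ENNReal.ofReal ε :=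
    minimalError_card_le hR hbdd hsum hfin.toFinset hε.le fun k hk => by simpa using hk
  rw [Set.ncard_eq_toFinset_card _ hfin]
  refine (Nat.sInf_le hupper).antisymm (le_csInf ⟨_, hupper⟩ fun n hn => ?_)
  by_contra! hlt
  obtain ⟨k₀, hk₀, hmin⟩ := hfin.toFinset.exists_min_image R (Finset.card_pos.mp (by omega))
  have hlower := (ofReal_sqrt_le_minimalError hR hbdd hsum _ hmin hlt).trans hn
  rw [ENNReal.ofReal_le_ofReal_iff hε.le, Real.sqrt_le_iff] at hlower
  exact (hfin.mem_toFinset.mp hk₀).not_ge hlower.2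

end Hermite

/-! ### The weights of the Gaussian ANOVA space -/

section Weights

variable {α γ : ℝ}

theorem anovaWeight₁_zero : anovaWeight₁ α γ 0 = 1 := if_pos rfl

theorem anovaWeight₁_eq_mul {k : ℕ} (hk : k ≠ 0) :
    anovaWeight₁ α γ k = γ * anovaWeight₁ α 1 k := by
  simp only [anovaWeight₁, if_neg hk]
  split_ifs <;> ring

theorem anovaWeight₁_pos (hγ : 0 < γ) (k : ℕ) : 0 < anovaWeight₁ α γ k := by
  unfold anovaWeight₁
  split_ifs with h1 h2
  · exact one_pos
  · positivity
  · have := Real.Gamma_pos_of_pos (s := (k : ℝ) - α + 1) (by linarith [not_lt.mp h2])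
    positivity

theorem anovaWeight₁_le_one (hα : 1 ≤ α) (hγ1 : γ ≤ 1) (k : ℕ) : anovaWeight₁ α γ k ≤ 1 := by
  cases k with
  | zero => exact anovaWeight₁_zero.le
  | succ k =>
    refine (anovaWeight₁_le hα hγ1 k).trans ?_
    rw [div_le_one (by positivity)]
    linarith [(Nat.cast_nonneg k : (0 : ℝ) ≤ k)]

theorem anovaWeight₁_one (hα : 1 ≤ α) : anovaWeight₁ α γ 1 = γ := by
  unfold anovaWeight₁
  rcases hα.lt_or_eq with h | h
  · simp [h]
  · simp [← h]

theorem anovaWeight₁_succ (hα : 1 ≤ α) {k : ℕ} (hk : α ≤ k) :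
    anovaWeight₁ α γ (k + 1) = ((k : ℝ) + 1 - α) / (k + 1) * anovaWeight₁ α γ k := by
  have hk0 : k ≠ 0 := by
    rintro rfl
    norm_num at hk
    linarith
  simp only [anovaWeight₁, if_neg hk0, if_neg (Nat.succ_ne_zero k), if_neg hk.not_gt]
  rw [if_neg (by push_cast; linarith)]
  push_cast
  rw [show (k : ℝ) + 1 - α + 1 = ((k : ℝ) - α + 1) + 1 by ring,
    Real.Gamma_add_one (by linarith), Nat.factorial_succ]
  push_cast
  field_simp
  ring

theorem antitoneOn_anovaWeight₁_mul_rpow (hα : 1 ≤ α) (hγ : 0 < γ) :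
    AntitoneOn (fun k : ℕ => anovaWeight₁ α γ k * (k : ℝ) ^ α) (Set.Ici ⌈α⌉₊) := by
  refine antitoneOn_of_add_one_le Set.ordConnected_Ici fun k _ hk _ => ?_
  have hαk : α ≤ k := Nat.ceil_le.mp hk
  have hk0 : (0 : ℝ) < k := by linarith
  have hk1 : (0 : ℝ) < (k : ℝ) + 1 := by linarith
  have bernoulli : 1 + α * -(1 / ((k : ℝ) + 1)) ≤ (1 + -(1 / ((k : ℝ) + 1))) ^ α :=
    one_add_mul_self_le_rpow_one_add (by
      rw [neg_le_neg_iff, div_le_one hk1]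
      linarith) hα
  rw [show 1 + -(1 / ((k : ℝ) + 1)) = k / (k + 1) by field_simp; ring,
    show 1 + α * -(1 / ((k : ℝ) + 1)) = ((k : ℝ) + 1 - α) / (k + 1) by field_simp; ring,
    Real.div_rpow hk0.le hk1.le, le_div_iff₀ (by positivity)] at bernoulli
  have := mul_le_mul_of_nonneg_left bernoulli (anovaWeight₁_pos (α := α) hγ k).le
  simp only [anovaWeight₁_succ hα hαk]
  push_cast
  linarith

theorem monotoneOn_anovaWeight₁_mul_rpow (hα : 1 ≤ α) (hγ : 0 < γ) :
    MonotoneOn (fun k : ℕ => anovaWeight₁ α γ k * ((k : ℝ) + 1 - α) ^ α) (Set.Ici ⌈α⌉₊) := by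
  refine monotoneOn_of_le_add_one Set.ordConnected_Ici fun k _ hk _ => ?_
  have hαk : α ≤ k := Nat.ceil_le.mp hk
  have hx : 0 < (k : ℝ) + 1 - α := by linarith
  have hk1 : (0 : ℝ) < (k : ℝ) + 1 := by linarith
  have bernoulli : 1 + α * (1 / ((k : ℝ) + 1 - α)) ≤ (1 + 1 / ((k : ℝ) + 1 - α)) ^ α :=
    one_add_mul_self_le_rpow_one_add (by linarith [one_div_pos.mpr hx]) hα
  rw [show 1 + 1 / ((k : ℝ) + 1 - α) = ((k : ℝ) + 1 + 1 - α) / (k + 1 - α) by field_simp; ring,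
    show 1 + α * (1 / ((k : ℝ) + 1 - α)) = ((k : ℝ) + 1) / (k + 1 - α) by field_simp; ring,
    Real.div_rpow (by linarith) hx.le, div_le_div_iff₀ hx (by positivity)] at bernoulli
  have := mul_le_mul_of_nonneg_left bernoulli (anovaWeight₁_pos (α := α) hγ k).le
  simp only [anovaWeight₁_succ hα hαk]
  push_cast
  rw [div_mul_eq_mul_div, div_mul_eq_mul_div, le_div_iff₀ hk1]
  linarith

theorem isTheta_anovaWeight₁ (hα : 1 ≤ α) (hγ : 0 < γ) :
    anovaWeight₁ α γ =Θ[atTop] fun k : ℕ => (k : ℝ) ^ (-α) := by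
  set m := ⌈α⌉₊
  have hαm : α ≤ m := Nat.le_ceil α
  have hpos : ∀ k, 0 < anovaWeight₁ α γ k := anovaWeight₁_pos hγ
  constructor
  · refine IsBigO.of_bound (anovaWeight₁ α γ m * (m : ℝ) ^ α) ?_
    filter_upwards [eventually_ge_atTop m] with k hk
    have hk0 : (0 : ℝ) < k := by linarith [(Nat.cast_le (α := ℝ)).mpr hk]
    rw [Real.norm_of_nonneg (hpos k).le, Real.norm_of_nonneg (by positivity),
      Real.rpow_neg hk0.le, ← div_eq_mul_inv, le_div_iff₀ (by positivity)]
    exact antitoneOn_anovaWeight₁_mul_rpow hα hγ Set.self_mem_Ici hk hk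
  · have hc : 0 < anovaWeight₁ α γ m * ((m : ℝ) + 1 - α) ^ α :=
      mul_pos (hpos m) (Real.rpow_pos_of_pos (by linarith) _)
    refine IsBigO.of_bound (anovaWeight₁ α γ m * ((m : ℝ) + 1 - α) ^ α)⁻¹ ?_
    filter_upwards [eventually_ge_atTop m] with k hk
    have hmk : (m : ℝ) ≤ k := Nat.cast_le.mpr hk
    have hk0 : (0 : ℝ) < k := by linarith
    rw [Real.norm_of_nonneg (hpos k).le, Real.norm_of_nonneg (by positivity),
      Real.rpow_neg hk0.le, inv_mul_eq_div, le_div_iff₀ hc, inv_mul_le_iff₀ (by positivity)]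
    calc anovaWeight₁ α γ m * ((m : ℝ) + 1 - α) ^ α
        ≤ anovaWeight₁ α γ k * ((k : ℝ) + 1 - α) ^ α :=
          monotoneOn_anovaWeight₁_mul_rpow hα hγ Set.self_mem_Ici hk hk
      _ ≤ anovaWeight₁ α γ k * (k : ℝ) ^ α := by
          gcongr
          · exact (hpos k).le
          · linarith
          · linarith
      _ = (k : ℝ) ^ α * anovaWeight₁ α γ k := mul_comm _ _

theorem summable_anovaWeight₁_rpow (hα : 1 ≤ α) (hγ : 0 < γ) {κ : ℝ} (hκ : 1 / α < κ) :
    Summable fun k : ℕ => anovaWeight₁ α γ k ^ κ := by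
  have hα0 : 0 < α := by linarith
  have hκ0 : 0 < κ := (one_div_pos.mpr hα0).trans hκ
  have hp : Summable fun k : ℕ => ((k : ℝ) ^ (-α)) ^ κ := by
    simp_rw [← Real.rpow_mul (Nat.cast_nonneg _), neg_mul, Real.summable_nat_rpow]
    linarith [(div_lt_iff₀' hα0).mp hκ]
  exact summable_of_isBigO_nat hp ((isTheta_anovaWeight₁ hα hγ).1.rpow hκ0.le
    (Eventually.of_forall fun _ => by positivity))

theorem exists_mul_rpow_le_anovaWeight₁ (hα : 1 ≤ α) (hγ : 0 < γ) :
    ∃ c : ℝ, 0 < c ∧ ∀ k : ℕ, c * (k : ℝ) ^ (-α) ≤ anovaWeight₁ α γ k := by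
  obtain ⟨C, hC, h⟩ := bound_of_isBigO_nat_atTop (isTheta_anovaWeight₁ hα hγ).2
  refine ⟨C⁻¹, inv_pos.mpr hC, fun k => ?_⟩
  have hk := h (anovaWeight₁_pos (α := α) hγ k).ne'
  rwa [Real.norm_of_nonneg (by positivity), Real.norm_of_nonneg (anovaWeight₁_nonneg hγ.le k),
    ← inv_mul_le_iff₀ hC] at hk

/-- The univariate weight sum `∑_{k ≥ 1} r_{α,1}(k)^κ`, finite for `κ > 1 / α`; the `κ`-th power
sum of the product weights is `∏_j (1 + γ_j^κ ζ)`. -/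
noncomputable def anovaZeta (α κ : ℝ) : ℝ := ∑' k : ℕ, anovaWeight₁ α 1 (k + 1) ^ κ

theorem anovaZeta_nonneg (α κ : ℝ) : 0 ≤ anovaZeta α κ :=
  tsum_nonneg fun _ => Real.rpow_nonneg (anovaWeight₁_nonneg zero_le_one _) _

theorem anovaZeta_anti {κ κ' : ℝ} (hα : 1 ≤ α) (hκ : 1 / α < κ) (h : κ ≤ κ') :
    anovaZeta α κ' ≤ anovaZeta α κ :=
  Summable.tsum_le_tsum
    (fun _ => Real.rpow_le_rpow_of_exponent_ge (anovaWeight₁_pos one_pos _)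
      (anovaWeight₁_le_one hα le_rfl _) h)
    ((summable_nat_add_iff 1).mpr (summable_anovaWeight₁_rpow hα one_pos (hκ.trans_le h)))
    ((summable_nat_add_iff 1).mpr (summable_anovaWeight₁_rpow hα one_pos hκ))

theorem tsum_anovaWeight₁_rpow (hα : 1 ≤ α) (hγ : 0 < γ) {κ : ℝ} (hκ : 1 / α < κ) :
    ∑' k, anovaWeight₁ α γ k ^ κ = 1 + γ ^ κ * anovaZeta α κ := by
  rw [(summable_anovaWeight₁_rpow hα hγ hκ).tsum_eq_zero_add, anovaWeight₁_zero, Real.one_rpow,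
    anovaZeta, ← tsum_mul_left]
  simp_rw [anovaWeight₁_eq_mul (α := α) (γ := γ) (Nat.succ_ne_zero _),
    Real.mul_rpow hγ.le (anovaWeight₁_nonneg zero_le_one _)]

end Weights

theorem sum_prod_le_prod_tsum {ι : Type*} [Fintype ι] {κ : ι → Type*} {a : ∀ j, κ j → ℝ}
    (h0 : ∀ j k, 0 ≤ a j k) (hs : ∀ j, Summable (a j)) (S : Finset (∀ j, κ j)) :
    ∑ k ∈ S, ∏ j, a j (k j) ≤ ∏ j, ∑' k, a j k := by
  classical
  have hS : S ⊆ Fintype.piFinset fun j => S.image (· j) := fun k hk =>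
    Fintype.mem_piFinset.mpr fun j => Finset.mem_image_of_mem _ hk
  calc ∑ k ∈ S, ∏ j, a j (k j)
      ≤ ∑ k ∈ Fintype.piFinset (fun j => S.image (· j)), ∏ j, a j (k j) :=
        Finset.sum_le_sum_of_subset_of_nonneg hS
          fun k _ _ => Finset.prod_nonneg fun j _ => h0 j _
    _ = ∏ j, ∑ i ∈ S.image (· j), a j i := (Finset.prod_univ_sum _ _).symm
    _ ≤ ∏ j, ∑' i, a j i := Finset.prod_le_prod (fun j _ => Finset.sum_nonneg fun i _ => h0 j i)
        fun j _ => (hs j).sum_le_tsum _ fun i _ => h0 j i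

section Complexity

variable {α : ℝ} (γ : ProductWeights) (s : ℕ)

theorem anovaWeight_pos (k : Fin s → ℕ) : 0 < anovaWeight α γ s k :=
  Finset.prod_pos fun j _ => anovaWeight₁_pos (γ.pos j) _

theorem bddAbove_range_anovaWeight (hα : 1 ≤ α) : BddAbove (Set.range (anovaWeight α γ s)) :=
  ⟨1, by
    rintro _ ⟨k, rfl⟩
    exact Finset.prod_le_one (fun j _ => anovaWeight₁_nonneg (γ.pos j).le _)
      fun j _ => anovaWeight₁_le_one hα (γ.le_one j) _⟩

theorem sum_anovaWeight_rpow_le (hα : 1 ≤ α) {κ : ℝ} (hκ : 1 / α < κ)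
    (S : Finset (Fin s → ℕ)) :
    ∑ k ∈ S, anovaWeight α γ s k ^ κ ≤ ∏ j : Fin s, (1 + γ j ^ κ * anovaZeta α κ) := by
  have hnonneg : ∀ (j : Fin s) k, 0 ≤ anovaWeight₁ α (γ j) k :=
    fun j => anovaWeight₁_nonneg (γ.pos j).le
  calc ∑ k ∈ S, anovaWeight α γ s k ^ κ
      = ∑ k ∈ S, ∏ j : Fin s, anovaWeight₁ α (γ j) (k j) ^ κ := by
        simp_rw [anovaWeight, Real.finsetProd_rpow _ _ fun j _ => hnonneg j _]
    _ ≤ ∏ j : Fin s, ∑' k, anovaWeight₁ α (γ j) k ^ κ :=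
        sum_prod_le_prod_tsum (fun j k => Real.rpow_nonneg (hnonneg j k) κ)
          (fun j => summable_anovaWeight₁_rpow hα (γ.pos j) hκ) S
    _ = ∏ j : Fin s, (1 + γ j ^ κ * anovaZeta α κ) :=
        Finset.prod_congr rfl fun j _ => tsum_anovaWeight₁_rpow hα (γ.pos j) hκ

theorem finite_lt_anovaWeight (hα : 1 ≤ α) {δ : ℝ} (hδ : 0 < δ) :
    {k | δ < anovaWeight α γ s k}.Finite := by
  have hκ : 1 / α < 2 := ((div_le_one (by linarith)).mpr hα).trans_lt one_lt_two
  have hs : Summable fun k => anovaWeight α γ s k ^ (2 : ℝ) :=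
    summable_of_sum_le (fun k => Real.rpow_nonneg (anovaWeight_pos γ s k).le _)
      (sum_anovaWeight_rpow_le γ s hα hκ)
  have h := hs.tendsto_cofinite_zero.eventually (gt_mem_nhds (Real.rpow_pos_of_pos hδ 2))
  refine (eventually_cofinite.mp h).subset fun k hk => ?_
  exact not_lt.mpr (Real.rpow_le_rpow hδ.le (le_of_lt hk) zero_le_two)

variable [hα : Fact (1 ≤ α)] {ε : ℝ}

theorem exists_minimalError_anovaWeight_le (hε : 0 < ε) :
    ∃ n : ℕ, minimalError (anovaWeight α γ s) n ≤ ENNReal.ofReal ε := by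
  have hfin := finite_lt_anovaWeight γ s hα.out (pow_pos hε 2)
  exact ⟨_, minimalError_card_le (anovaWeight_pos γ s) (bddAbove_range_anovaWeight γ s hα.out)
    (summable_anovaWeight_mul_sq hα.out γ s) hfin.toFinset hε.le fun k hk => by simpa using hk⟩

theorem anovaComplexity_eq_ncard (hε : 0 < ε) :
    anovaComplexity α γ ε s = {k | ε ^ 2 < anovaWeight α γ s k}.ncard :=
  infoComplexity_eq_ncard (anovaWeight_pos γ s) (bddAbove_range_anovaWeight γ s hα.out)
    (summable_anovaWeight_mul_sq hα.out γ s) hε (finite_lt_anovaWeight γ s hα.out (pow_pos hε 2))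

theorem anovaComplexity_le (hε : 0 < ε) {κ : ℝ} (hκ : 1 / α < κ) :
    (anovaComplexity α γ ε s : ℝ)
      ≤ ε ^ (-(2 * κ)) * ∏ j : Fin s, (1 + γ j ^ κ * anovaZeta α κ) := by
  have hκ0 : 0 < κ := (one_div_pos.mpr (by linarith [hα.out])).trans hκ
  have hfin := finite_lt_anovaWeight γ s hα.out (pow_pos hε 2)
  rw [anovaComplexity_eq_ncard γ s hε, Set.ncard_eq_toFinset_card _ hfin, Real.rpow_neg hε.le,
    inv_mul_eq_div, le_div_iff₀ (by positivity), ← nsmul_eq_mul]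
  refine (Finset.card_nsmul_le_sum _ _ _ fun k hk => ?_).trans
    (sum_anovaWeight_rpow_le γ s hα.out hκ hfin.toFinset)
  rw [Real.rpow_mul hε.le, Real.rpow_two]
  exact Real.rpow_le_rpow (sq_nonneg _) (hfin.mem_toFinset.mp hk).le hκ0.le

theorem card_le_anovaComplexity (hε : 0 < ε) {ι : Type*} {k : ι → Fin s → ℕ}
    (hk : Function.Injective k) (A : Finset ι)
    (hA : ∀ i ∈ A, ε ^ 2 < anovaWeight α γ s (k i)) : A.card ≤ anovaComplexity α γ ε s := by
  rw [anovaComplexity_eq_ncard γ s hε, ← Set.ncard_coe_finset A,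
    ← Set.ncard_image_of_injective _ hk]
  refine Set.ncard_le_ncard ?_ (finite_lt_anovaWeight γ s hα.out (pow_pos hε 2))
  rintro _ ⟨i, hi, rfl⟩
  exact hA i hi

theorem anovaWeight_indicator_one (A : Finset (Fin s)) :
    anovaWeight α γ s ((A : Set (Fin s)).indicator 1) = ∏ j ∈ A, γ j := by
  classical
  rw [anovaWeight, ← Finset.prod_subset A.subset_univ fun j _ hj => by
    simp [hj, anovaWeight₁_zero]]
  exact Finset.prod_congr rfl fun j hj => by simp [hj, anovaWeight₁_one hα.out]

theorem card_subsets_le_anovaComplexity (hε : 0 < ε) (𝒜 : Finset (Finset (Fin s)))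
    (h𝒜 : ∀ A ∈ 𝒜, ε ^ 2 < ∏ j ∈ A, γ j) : 𝒜.card ≤ anovaComplexity α γ ε s :=
  card_le_anovaComplexity γ s hε
    (fun _ _ h => Finset.coe_injective (Set.indicator_one_inj ℕ h)) 𝒜
    fun A hA => (h𝒜 A hA).trans_eq (anovaWeight_indicator_one γ s A).symm

theorem choose_le_anovaComplexity (hε : 0 < ε) {δ : ℝ} (hδ : 0 ≤ δ) (hδγ : ∀ j < s, δ ≤ γ j)
    {m : ℕ} (h : ε ^ 2 < δ ^ m) : s.choose m ≤ anovaComplexity α γ ε s := by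
  have hcard : (Finset.powersetCard m (Finset.univ : Finset (Fin s))).card = s.choose m := by simp
  rw [← hcard]
  refine card_subsets_le_anovaComplexity γ s hε _ fun A hA => h.trans_le ?_
  rw [← (Finset.mem_powersetCard.mp hA).2, ← Finset.prod_const]
  exact Finset.prod_le_prod (fun _ _ => hδ) fun j _ => hδγ j j.2

variable (α) in
theorem exists_le_anovaComplexity_one : ∃ c ∈ Set.Ioo (0 : ℝ) 1, ∀ K : ℕ, K ≠ 0 →
    K ≤ anovaComplexity α γ (c * (K : ℝ) ^ (-(α / 2))) 1 := by
  obtain ⟨c, hc, h⟩ := exists_mul_rpow_le_anovaWeight₁ hα.out (γ.pos 0)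
  obtain ⟨d, hd0, hd⟩ := exists_between (lt_min hc one_pos)
  refine ⟨√d, ⟨Real.sqrt_pos.mpr hd0, ?_⟩, fun K hK => ?_⟩
  · rw [Real.sqrt_lt' one_pos, one_pow]
    exact hd.trans_le (min_le_right _ _)
  have hK0 : (0 : ℝ) < K := by positivity
  have hinj : Function.Injective fun (k : ℕ) (_ : Fin 1) => k := fun k l h => congrFun h 0
  have hcard := card_le_anovaComplexity (α := α) γ 1 (by positivity) hinj (Finset.Icc 1 K)
    (ε := √d * (K : ℝ) ^ (-(α / 2))) fun k hk => ?_
  · simpa using hcard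
  obtain ⟨hk1, hkK⟩ := Finset.mem_Icc.mp hk
  calc (√d * (K : ℝ) ^ (-(α / 2))) ^ 2
      = d * (K : ℝ) ^ (-α) := by
        rw [mul_pow, Real.sq_sqrt hd0.le, ← Real.rpow_mul_natCast hK0.le]
        congr 2
        push_cast
        ring
    _ < c * (K : ℝ) ^ (-α) := by
        gcongr
        exact hd.trans_le (min_le_left _ _)
    _ ≤ c * (k : ℝ) ^ (-α) := by
        gcongr ?_ * ?_
        exact Real.rpow_le_rpow_of_nonpos (by exact_mod_cast hk1) (by exact_mod_cast hkK)
          (by linarith [hα.out])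
    _ ≤ anovaWeight α γ 1 fun _ => k := by simpa [anovaWeight] using h k

end Complexity

/-! ### Bounds for the information complexity -/

section Calculus

theorem le_of_isBigO_natCast_rpow {a b : ℝ}
    (h : (fun n : ℕ => (n : ℝ) ^ a) =O[atTop] fun n : ℕ => (n : ℝ) ^ b) : a ≤ b := by
  by_contra! hab
  have hdiv : (fun n : ℕ => (n : ℝ) ^ (a - b)) =O[atTop] fun _ => (1 : ℝ) := by
    refine ((h.mul (isBigO_refl (fun n : ℕ => ((n : ℝ) ^ b)⁻¹) _)).congr' ?_ ?_) <;>
      filter_upwards [eventually_gt_atTop 0] with n hn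
    · rw [Real.rpow_sub (by positivity), div_eq_mul_inv]
    · exact mul_inv_cancel₀ (by positivity)
  have hlim : Tendsto (fun n : ℕ => (n : ℝ) ^ (a - b)) atTop atTop :=
    (tendsto_rpow_atTop (sub_pos.mpr hab)).comp tendsto_natCast_atTop_atTop
  refine not_isBoundedUnder_of_tendsto_atTop hlim ?_
  exact hdiv.isBoundedUnder_le.mono_le (Eventually.of_forall fun n => le_abs_self _)

theorem rpow_half_div_two_mem_Ioo {δ : ℝ} (h0 : 0 < δ) (h1 : δ ≤ 1) (m : ℕ) :
    δ ^ (m / 2 : ℝ) / 2 ∈ Set.Ioo (0 : ℝ) 1 :=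
  ⟨by positivity, by linarith [Real.rpow_le_one h0.le h1 (by positivity : (0 : ℝ) ≤ m / 2)]⟩

theorem sq_rpow_half_div_two_lt {δ : ℝ} (h0 : 0 < δ) (m : ℕ) :
    (δ ^ (m / 2 : ℝ) / 2) ^ 2 < δ ^ m := by
  have h : (δ ^ (m / 2 : ℝ)) ^ 2 = δ ^ m := by
    rw [← Real.rpow_mul_natCast h0.le, ← Real.rpow_natCast]
    congr 1
    push_cast
    ring
  rw [div_pow, h]
  linarith [pow_pos h0 m]

end Calculus

section SumExponent

variable {γ : ProductWeights} {κ κ' : ℝ}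

theorem summable_weight_rpow_mono (h : Summable fun j => γ j ^ κ) (hκ : κ ≤ κ') :
    Summable fun j => γ j ^ κ' :=
  h.of_nonneg_of_le (fun j => Real.rpow_nonneg (γ.pos j).le _) fun j =>
    Real.rpow_le_rpow_of_exponent_ge (γ.pos j) (γ.le_one j) hκ

theorem sumExponent_le (hκ : 0 < κ) (h : Summable fun j => γ j ^ κ) :
    sumExponent γ ≤ ENNReal.ofReal κ :=
  iInf_le_of_le κ (iInf_le_of_le hκ (iInf_le _ h))

theorem summable_weight_rpow_of_sumExponent_lt (h : sumExponent γ < ENNReal.ofReal κ) :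
    Summable fun j => γ j ^ κ := by
  simp only [sumExponent, iInf_lt_iff] at h
  obtain ⟨κ', -, hs, hlt⟩ := h
  exact summable_weight_rpow_mono hs (ENNReal.ofReal_lt_ofReal_iff'.mp hlt).1.le

end SumExponent

section WeightInf

variable (γ : ProductWeights)

theorem weightInf_le (j : ℕ) : weightInf γ ≤ γ j :=
  ciInf_le ⟨0, Set.forall_mem_range.mpr fun j => (γ.pos j).le⟩ j

theorem weightInf_nonneg : 0 ≤ weightInf γ :=
  le_ciInf fun j => (γ.pos j).le

end WeightInf

/-- The bound `n(ε, s) ≤ C ε^(-τ)` of strong polynomial tractability; the exponent of SPT is the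
infimum of the admissible `τ ≥ 0`. -/
def IsSPTBound (n : ℝ → ℕ → ℕ) (τ : ℝ) : Prop :=
  ∃ C : ℝ, 0 < C ∧ ∀ s : ℕ, 1 ≤ s → ∀ ε ∈ Set.Ioo (0 : ℝ) 1, (n ε s : ℝ) ≤ C * ε ^ (-τ)

/-- The bound `n(ε, s) ≤ C exp(τ (1 + ln s) (1 + ln ε⁻¹))` of quasi-polynomial tractability; the
exponent of QPT is the infimum of the admissible `τ ≥ 0`. -/
def IsQPTBound (n : ℝ → ℕ → ℕ) (τ : ℝ) : Prop :=
  ∃ C : ℝ, 0 < C ∧ ∀ s : ℕ, 1 ≤ s → ∀ ε ∈ Set.Ioo (0 : ℝ) 1,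
    (n ε s : ℝ) ≤ C * Real.exp (τ * (1 + Real.log s) * (1 + Real.log ε⁻¹))

theorem exp_mul_one_add_log_inv {τ ε : ℝ} (hε : 0 < ε) :
    Real.exp (τ * (1 + Real.log ε⁻¹)) = Real.exp τ * ε ^ (-τ) := by
  rw [Real.rpow_def_of_pos hε, ← Real.exp_add, Real.log_inv]
  congr 1
  ring

section UpperBounds

variable {α κ : ℝ} [hα : Fact (1 ≤ α)]

theorem anovaComplexity_le_exp (γ : ProductWeights) (s : ℕ) {ε : ℝ} (hε : 0 < ε)
    (hκ : 1 / α < κ) : (anovaComplexity α γ ε s : ℝ)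
      ≤ Real.exp ((∑ j ∈ Finset.range s, γ j ^ κ) * anovaZeta α κ) * ε ^ (-(2 * κ)) := by
  refine (anovaComplexity_le γ s hε hκ).trans ?_
  rw [mul_comm, Finset.sum_mul, ← Fin.sum_univ_eq_sum_range fun j => γ j ^ κ * anovaZeta α κ]
  gcongr
  exact Real.prod_one_add_le_exp_sum _ fun j =>
    mul_nonneg (Real.rpow_nonneg (γ.pos _).le _) (anovaZeta_nonneg α κ)

variable {γ : ProductWeights}

theorem isSPTBound_of_summable (hκ : 1 / α < κ) (hγ : Summable fun j => γ j ^ κ) :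
    IsSPTBound (anovaComplexity α γ) (2 * κ) := by
  refine ⟨Real.exp ((∑' j, γ j ^ κ) * anovaZeta α κ), Real.exp_pos _, fun s _ ε hε =>
    (anovaComplexity_le_exp γ s hε.1 hκ).trans ?_⟩
  have hsum : ∑ j ∈ Finset.range s, γ j ^ κ ≤ ∑' j, γ j ^ κ :=
    hγ.sum_le_tsum _ fun j _ => Real.rpow_nonneg (γ.pos j).le _
  have hζ := anovaZeta_nonneg α κ
  have hε0 := hε.1
  gcongr

theorem sum_weight_rpow_mul_one_add_log_le (hκ : 0 < κ) {j₀ : ℕ} (hj₀ : γ j₀ < Real.exp (-κ⁻¹))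
    {s : ℕ} (hs : 1 ≤ s) :
    ∑ j ∈ Finset.range s, γ j ^ (κ * (1 + Real.log s)) ≤ j₀ + 1 := by
  have hs1 : (1 : ℝ) ≤ s := Nat.one_le_cast.mpr hs
  have hpow_nonneg : 0 ≤ κ * (1 + Real.log s) :=
    mul_nonneg hκ.le (by linarith [Real.log_nonneg hs1])
  have head (j : ℕ) : γ j ^ (κ * (1 + Real.log s)) ≤ 1 :=
    Real.rpow_le_one (γ.pos j).le (γ.le_one j) hpow_nonneg
  have tail (j : ℕ) (hj : j₀ ≤ j) : γ j ^ (κ * (1 + Real.log s)) ≤ (s : ℝ)⁻¹ := by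
    calc γ j ^ (κ * (1 + Real.log s))
        ≤ Real.exp (-κ⁻¹) ^ (κ * (1 + Real.log s)) :=
          Real.rpow_le_rpow (γ.pos j).le ((γ.antitone hj).trans hj₀.le) hpow_nonneg
      _ = Real.exp (-(1 + Real.log s)) := by
          rw [← Real.exp_mul]
          congr 1
          field_simp
      _ ≤ Real.exp (-Real.log s) := Real.exp_le_exp.mpr (by linarith)
      _ = (s : ℝ)⁻¹ := by rw [Real.exp_neg, Real.exp_log (by linarith)]
  calc ∑ j ∈ Finset.range s, γ j ^ (κ * (1 + Real.log s))
      ≤ ∑ j ∈ Finset.range (j₀ + s), γ j ^ (κ * (1 + Real.log s)) :=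
        Finset.sum_le_sum_of_subset_of_nonneg (Finset.range_mono (Nat.le_add_left s j₀))
          fun j _ _ => Real.rpow_nonneg (γ.pos j).le _
    _ = ∑ j ∈ Finset.range j₀, γ j ^ (κ * (1 + Real.log s))
          + ∑ i ∈ Finset.range s, γ (j₀ + i) ^ (κ * (1 + Real.log s)) :=
        Finset.sum_range_add _ _ _
    _ ≤ ∑ _j ∈ Finset.range j₀, (1 : ℝ) + ∑ _i ∈ Finset.range s, (s : ℝ)⁻¹ := by
        gcongr with j _ i
        · exact head j
        · exact tail _ (Nat.le_add_right _ _)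
    _ = j₀ + 1 := by
        simp [mul_inv_cancel₀ (by linarith : (s : ℝ) ≠ 0)]

-- The moment of order `κ (1 + ln s)`, growing with `s`, keeps the power sum of the weights bounded.
theorem isQPTBound_of_weightInf_lt (hκ : 1 / α < κ) (hγ : weightInf γ < Real.exp (-κ⁻¹)) :
    IsQPTBound (anovaComplexity α γ) (2 * κ) := by
  have hκ0 : 0 < κ := (one_div_pos.mpr (by linarith [hα.out])).trans hκ
  obtain ⟨j₀, hj₀⟩ := exists_lt_of_ciInf_lt hγ
  refine ⟨Real.exp ((j₀ + 1) * anovaZeta α κ), Real.exp_pos _, fun s hs ε hε => ?_⟩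
  have hle : κ ≤ κ * (1 + Real.log s) :=
    le_mul_of_one_le_right hκ0.le (by linarith [Real.log_natCast_nonneg s])
  have hε_pow : ε ^ (-(2 * (κ * (1 + Real.log s))))
      ≤ Real.exp (2 * κ * (1 + Real.log s) * (1 + Real.log ε⁻¹)) := by
    rw [exp_mul_one_add_log_inv hε.1, mul_assoc]
    exact le_mul_of_one_le_left (Real.rpow_nonneg hε.1.le _) (Real.one_le_exp (by linarith))
  calc (anovaComplexity α γ ε s : ℝ)
      ≤ Real.exp ((∑ j ∈ Finset.range s, γ j ^ (κ * (1 + Real.log s)))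
          * anovaZeta α (κ * (1 + Real.log s))) * ε ^ (-(2 * (κ * (1 + Real.log s)))) :=
        anovaComplexity_le_exp γ s hε.1 (hκ.trans_le hle)
    _ ≤ Real.exp ((j₀ + 1) * anovaZeta α κ)
          * Real.exp (2 * κ * (1 + Real.log s) * (1 + Real.log ε⁻¹)) := by
        have hζ := anovaZeta_nonneg α (κ * (1 + Real.log s))
        have hε0 := hε.1
        gcongr
        · exact sum_weight_rpow_mul_one_add_log_le hκ0 hj₀ hs
        · exact anovaZeta_anti hα.out hκ hle

end UpperBounds

section LowerBounds

variable {α : ℝ} [hα : Fact (1 ≤ α)] {γ : ProductWeights} {C τ σ κ : ℝ}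

theorem one_div_le_of_anovaComplexity_one_le
    (h : ∀ ε ∈ Set.Ioo (0 : ℝ) 1, (anovaComplexity α γ ε 1 : ℝ) ≤ C * ε ^ (-τ)) :
    1 / α ≤ τ / 2 := by
  have hα0 : 0 < α := one_pos.trans_le hα.out
  obtain ⟨c, hc, hK⟩ := exists_le_anovaComplexity_one α γ
  suffices 1 ≤ α * τ / 2 by
    rw [div_le_iff₀ hα0]
    linarith
  refine le_of_isBigO_natCast_rpow (IsBigO.of_bound (C * c ^ (-τ)) ?_)
  filter_upwards [eventually_ge_atTop 1] with K hK1
  have hK0 : (0 : ℝ) < K := by positivity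
  have hmem : c * (K : ℝ) ^ (-(α / 2)) ∈ Set.Ioo (0 : ℝ) 1 :=
    ⟨mul_pos hc.1 (by positivity), mul_lt_one_of_nonneg_of_lt_one_left hc.1.le hc.2
      (Real.rpow_le_one_of_one_le_of_nonpos (Nat.one_le_cast.mpr hK1) (by linarith))⟩
  rw [Real.rpow_one, Real.norm_of_nonneg hK0.le, Real.norm_of_nonneg (by positivity)]
  calc (K : ℝ) ≤ anovaComplexity α γ (c * (K : ℝ) ^ (-(α / 2))) 1 := by
        exact_mod_cast hK K (by omega)
    _ ≤ C * (c * (K : ℝ) ^ (-(α / 2))) ^ (-τ) := h _ hmem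
    _ = C * c ^ (-τ) * (K : ℝ) ^ (α * τ / 2) := by
        rw [Real.mul_rpow hc.1.le (by positivity), ← Real.rpow_mul hK0.le, ← mul_assoc]
        congr 2
        ring

theorem choose_le_anovaComplexity_rpow {s m : ℕ} {δ : ℝ} (hδ : 0 < δ) (hδγ : ∀ j < s, δ ≤ γ j) :
    s.choose m ≤ anovaComplexity α γ (δ ^ (m / 2 : ℝ) / 2) s :=
  choose_le_anovaComplexity γ s (by positivity) hδ.le hδγ (sq_rpow_half_div_two_lt hδ m)

theorem isBigO_weight_rpow
    (h : ∀ s : ℕ, 1 ≤ s → ∀ ε ∈ Set.Ioo (0 : ℝ) 1,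
      (anovaComplexity α γ ε s : ℝ) ≤ C * ε ^ (-τ) * (s : ℝ) ^ σ) (m : ℕ) :
    (fun s => γ s ^ (m * τ / 2)) =O[atTop] fun s : ℕ => (s : ℝ) ^ (σ - m) := by
  have hchoose : (fun s : ℕ => γ s ^ (m * τ / 2) * (s.choose m : ℝ))
      =O[atTop] fun s : ℕ => (s : ℝ) ^ σ := by
    refine IsBigO.of_bound (C * 2 ^ τ) ?_
    filter_upwards [eventually_ge_atTop 1] with s hs
    have hγ := γ.pos s
    rw [Real.norm_of_nonneg (by positivity), Real.norm_of_nonneg (by positivity)]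
    calc γ s ^ (m * τ / 2) * (s.choose m : ℝ)
        ≤ γ s ^ (m * τ / 2) * anovaComplexity α γ (γ s ^ (m / 2 : ℝ) / 2) s := by
          gcongr
          exact choose_le_anovaComplexity_rpow hγ fun j hj => γ.antitone hj.le
      _ ≤ γ s ^ (m * τ / 2) * (C * (γ s ^ (m / 2 : ℝ) / 2) ^ (-τ) * (s : ℝ) ^ σ) := by
          gcongr
          exact h s hs _ (rpow_half_div_two_mem_Ioo hγ (γ.le_one s) m)
      _ = C * 2 ^ τ * (s : ℝ) ^ σ := by
          rw [Real.div_rpow (by positivity) zero_le_two, ← Real.rpow_mul hγ.le,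
            Real.rpow_neg zero_le_two, show (m / 2 : ℝ) * -τ = -(m * τ / 2) by ring,
            Real.rpow_neg hγ.le]
          field_simp
  have hpow := (hchoose.mul (isTheta_choose m).inv.1)
  refine hpow.congr' ?_ ?_ <;> filter_upwards [eventually_ge_atTop (m + 1)] with s hs
  · have : (s.choose m : ℝ) ≠ 0 := by exact_mod_cast (Nat.choose_pos (by omega)).ne'
    field_simp
  · rw [Real.rpow_sub_natCast (by norm_cast; omega), div_eq_mul_inv]

theorem summable_weight_rpow_of_anovaComplexity_le
    (h : ∀ s : ℕ, 1 ≤ s → ∀ ε ∈ Set.Ioo (0 : ℝ) 1,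
      (anovaComplexity α γ ε s : ℝ) ≤ C * ε ^ (-τ) * (s : ℝ) ^ σ) (hκ : τ / 2 < κ) :
    Summable fun j => γ j ^ κ := by
  have hτ : 0 < τ / 2 := by
    refine (one_div_pos.mpr (one_pos.trans_le hα.out)).trans_le
      (one_div_le_of_anovaComplexity_one_le (α := α) (γ := γ) (C := C) fun ε hε => ?_)
    simpa using h 1 le_rfl ε hε
  obtain ⟨m, hm⟩ := exists_nat_gt (max 0 (2 * κ * σ / (2 * κ - τ)))
  rw [max_lt_iff, div_lt_iff₀ (by linarith)] at hm
  have hexp : 0 < m * τ / 2 := mul_div_assoc (m : ℝ) τ 2 ▸ mul_pos hm.1 hτ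
  refine summable_of_isBigO_nat (g := fun s : ℕ => ((s : ℝ) ^ (σ - m)) ^ (κ / (m * τ / 2))) ?_ ?_
  · simp_rw [← Real.rpow_mul (Nat.cast_nonneg _), Real.summable_nat_rpow, ← mul_div_assoc]
    rw [div_lt_iff₀ hexp]
    linarith [hm.2]
  · refine ((isBigO_weight_rpow h m).rpow (div_nonneg (by linarith) hexp.le)
      (Eventually.of_forall fun s => by positivity)).congr_left fun s => ?_
    rw [← Real.rpow_mul (γ.pos s).le, mul_div_cancel₀ _ hexp.ne']

theorem natCast_le_of_anovaComplexity_le_exp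
    (h : ∀ s : ℕ, 1 ≤ s → ∀ ε ∈ Set.Ioo (0 : ℝ) 1, (anovaComplexity α γ ε s : ℝ)
      ≤ C * Real.exp (τ * (1 + Real.log s) * (1 + Real.log ε⁻¹)))
    (hγ : 0 < weightInf γ) (m : ℕ) :
    (m : ℝ) ≤ τ * (1 + Real.log 2 + m / 2 * Real.log (weightInf γ)⁻¹) := by
  set E := 1 + Real.log 2 + m / 2 * Real.log (weightInf γ)⁻¹ with hE
  have hlog : 1 + Real.log (weightInf γ ^ (m / 2 : ℝ) / 2)⁻¹ = E := by
    rw [inv_div, Real.log_div two_ne_zero (by positivity), Real.log_rpow hγ, hE, Real.log_inv]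
    ring
  have hchoose : (fun s : ℕ => (s.choose m : ℝ)) =O[atTop] fun s : ℕ => (s : ℝ) ^ (τ * E) := by
    refine IsBigO.of_bound (C * Real.exp (τ * E)) ?_
    filter_upwards [eventually_ge_atTop 1] with s hs
    rw [Real.norm_of_nonneg (by positivity), Real.norm_of_nonneg (by positivity)]
    calc (s.choose m : ℝ)
        ≤ anovaComplexity α γ (weightInf γ ^ (m / 2 : ℝ) / 2) s :=
          Nat.cast_le.mpr (choose_le_anovaComplexity_rpow hγ fun j _ => weightInf_le γ j)
      _ ≤ C * Real.exp (τ * (1 + Real.log s) * E) := by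
          rw [← hlog]
          exact h s hs _ (rpow_half_div_two_mem_Ioo hγ ((weightInf_le γ 0).trans (γ.le_one 0)) m)
      _ = C * Real.exp (τ * E) * (s : ℝ) ^ (τ * E) := by
          rw [Real.rpow_def_of_pos (by positivity), mul_assoc C, ← Real.exp_add]
          congr 2
          ring
  refine le_of_isBigO_natCast_rpow (((isTheta_choose m).2.trans hchoose).congr_left fun s => ?_)
  exact (Real.rpow_natCast _ _).symm

theorem IsQPTBound.one_le_mul_log (h : IsQPTBound (anovaComplexity α γ) τ)
    (hγ : 0 < weightInf γ) : 1 ≤ τ / 2 * Real.log (weightInf γ)⁻¹ := by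
  obtain ⟨C, -, h⟩ := h
  by_contra! hlt
  obtain ⟨m, hm⟩ := exists_nat_gt (τ * (1 + Real.log 2) / (1 - τ / 2 * Real.log (weightInf γ)⁻¹))
  rw [div_lt_iff₀ (by linarith)] at hm
  linarith [natCast_le_of_anovaComplexity_le_exp h hγ m]

end LowerBounds

/-! ### Weak tractability -/

section Limit

variable {σ τ θ : ℝ}

theorem eventually_limitFilter_mem :
    ∀ᶠ p : ℝ × ℕ in limitFilter, p.1 ∈ Set.Ioo (0 : ℝ) 1 ∧ 1 ≤ p.2 :=
  mem_inf_of_right (mem_principal_self _)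

theorem tendsto_prodMk_limitFilter {ε : ℝ} (hε : ε ∈ Set.Ioo (0 : ℝ) 1) :
    Tendsto (fun s : ℕ => (ε, s)) atTop limitFilter :=
  tendsto_inf.mpr ⟨tendsto_comap_iff.mpr
      (tendsto_atTop_add_const_right _ ε⁻¹ tendsto_natCast_atTop_atTop),
    tendsto_principal.mpr ((eventually_ge_atTop 1).mono fun _ hs => ⟨hε, hs⟩)⟩

theorem tendsto_limitFilter_atTop (hσ : 0 < σ) (hτ : 0 < τ) :
    Tendsto (fun p : ℝ × ℕ => (p.2 : ℝ) ^ σ + p.1 ^ (-τ)) limitFilter atTop := by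
  let ρ := min (min σ τ) 1
  have hρ0 : 0 < ρ := lt_min (lt_min hσ hτ) one_pos
  have hρσ : ρ ≤ σ := (min_le_left _ _).trans (min_le_left _ _)
  have hρτ : ρ ≤ τ := (min_le_left _ _).trans (min_le_right _ _)
  have hsum : Tendsto (fun p : ℝ × ℕ => (p.2 : ℝ) + p.1⁻¹) limitFilter atTop :=
    tendsto_comap.mono_left inf_le_left
  refine tendsto_atTop_mono' _ ?_ ((tendsto_rpow_atTop hρ0).comp hsum)
  filter_upwards [eventually_limitFilter_mem] with p ⟨hε, hs⟩
  calc ((p.2 : ℝ) + p.1⁻¹) ^ ρ ≤ (p.2 : ℝ) ^ ρ + p.1⁻¹ ^ ρ :=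
        Real.rpow_add_le_add_rpow (by positivity) (inv_nonneg.mpr hε.1.le) hρ0.le
          (min_le_right _ _)
    _ ≤ (p.2 : ℝ) ^ σ + p.1⁻¹ ^ τ :=
        add_le_add (Real.rpow_le_rpow_of_exponent_le (Nat.one_le_cast.mpr hs) hρσ)
          (Real.rpow_le_rpow_of_exponent_le ((one_le_inv₀ hε.1).mpr hε.2.le) hρτ)
    _ = (p.2 : ℝ) ^ σ + p.1 ^ (-τ) := by rw [Real.inv_rpow hε.1.le, Real.rpow_neg hε.1.le]

theorem tendsto_limitFilter_div_zero (hσ : 0 < σ) (hτ : 0 < τ) (hθ : θ ∈ Set.Ioo (0 : ℝ) 1) :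
    Tendsto (fun p : ℝ × ℕ => ((p.2 : ℝ) ^ (σ * θ) + p.1 ^ (-τ * θ)) /
      ((p.2 : ℝ) ^ σ + p.1 ^ (-τ))) limitFilter (𝓝 0) := by
  have hD := tendsto_limitFilter_atTop hσ hτ
  have hlim : Tendsto (fun p : ℝ × ℕ => 2 * ((p.2 : ℝ) ^ σ + p.1 ^ (-τ)) ^ (-(1 - θ)))
      limitFilter (𝓝 0) := by
    simpa using ((tendsto_rpow_neg_atTop (sub_pos.mpr hθ.2)).comp hD).const_mul 2
  refine squeeze_zero' ?_ ?_ hlim <;> filter_upwards [eventually_limitFilter_mem,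
    hD.eventually_gt_atTop 0] with p ⟨hε, hs⟩ hp
  · have hε0 := hε.1
    positivity
  · have hε0 := hε.1
    rw [div_le_iff₀ hp, mul_assoc, ← Real.rpow_add_one hp.ne', show -(1 - θ) + 1 = θ by ring,
      Real.rpow_mul (by positivity), Real.rpow_mul hε0.le, two_mul]
    gcongr
    · exact hθ.1.le
    · exact le_add_of_nonneg_right (by positivity)
    · exact hθ.1.le
    · exact le_add_of_nonneg_left (by positivity)

end Limit

section Weak

variable {n : ℝ → ℕ → ℕ}

theorem weakTractability_of_log_le {σ τ θ C : ℝ} (hσ : 0 < σ) (hτ : 0 < τ)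
    (hθ : θ ∈ Set.Ioo (0 : ℝ) 1) (h : ∀ s : ℕ, 1 ≤ s → ∀ ε ∈ Set.Ioo (0 : ℝ) 1,
      Real.log (n ε s) ≤ C * ((s : ℝ) ^ (σ * θ) + ε ^ (-τ * θ))) : WeakTractability n σ τ := by
  refine squeeze_zero' ?_ ?_
    (mul_zero C ▸ (tendsto_limitFilter_div_zero hσ hτ hθ).const_mul C) <;>
    filter_upwards [eventually_limitFilter_mem] with p ⟨hε, hs⟩
  · have hε0 := hε.1
    exact div_nonneg (Real.log_natCast_nonneg _) (by positivity)
  · have hε0 := hε.1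
    rw [← mul_div_assoc]
    gcongr
    exact h p.2 hs p.1 hε

-- `Real.log 0 = 0`, so the bound also covers `k = 0`.
theorem log_natCast_le_of_le_exp {k : ℕ} {b : ℝ} (hb : 0 ≤ b) (h : (k : ℝ) ≤ Real.exp b) :
    Real.log k ≤ b := by
  rcases k.eq_zero_or_pos with rfl | hk
  · simpa using hb
  · exact (Real.log_le_iff_le_exp (Nat.cast_pos.mpr hk)).mpr h

theorem one_add_log_le {x p : ℝ} (hx : 1 ≤ x) (hp : 0 < p) :
    1 + Real.log x ≤ (1 + 1 / p) * x ^ p := by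
  rw [add_mul, one_mul, one_div_mul_eq_div]
  exact add_le_add (Real.one_le_rpow hx hp.le) (Real.log_le_rpow_div (by linarith) hp)

theorem one_add_log_mul_one_add_log_le {x y p q : ℝ} (hx : 1 ≤ x) (hy : 1 ≤ y) (hp : 0 < p)
    (hq : 0 < q) : (1 + Real.log x) * (1 + Real.log y)
      ≤ (1 + 1 / p) * (1 + 1 / q) * (x ^ (2 * p) + y ^ (2 * q)) := by
  have hx0 : 0 ≤ x := by linarith
  have hy0 : 0 ≤ y := by linarith
  have amgm : x ^ p * y ^ q ≤ x ^ (2 * p) + y ^ (2 * q) := by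
    rw [mul_comm 2 p, mul_comm 2 q, Real.rpow_mul hx0, Real.rpow_mul hy0, Real.rpow_two,
      Real.rpow_two]
    nlinarith [two_mul_le_add_sq (x ^ p) (y ^ q), sq_nonneg (x ^ p), sq_nonneg (y ^ q)]
  calc (1 + Real.log x) * (1 + Real.log y)
      ≤ ((1 + 1 / p) * x ^ p) * ((1 + 1 / q) * y ^ q) :=
        mul_le_mul (one_add_log_le hx hp) (one_add_log_le hy hq)
          (by linarith [Real.log_nonneg hy]) (by positivity)
    _ = (1 + 1 / p) * (1 + 1 / q) * (x ^ p * y ^ q) := by ring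
    _ ≤ (1 + 1 / p) * (1 + 1 / q) * (x ^ (2 * p) + y ^ (2 * q)) := by gcongr

theorem QPT.uwt (h : QPT n) : UWT n := by
  obtain ⟨τ₀, C, hτ₀, hC, h⟩ := h
  rintro σ ⟨hσ, -⟩ τ ⟨hτ, -⟩
  set A := (1 + 1 / (σ / 4)) * (1 + 1 / (τ / 4))
  have hlogC : 0 ≤ Real.log (C + 1) := Real.log_nonneg (by linarith)
  refine weakTractability_of_log_le (θ := 1 / 2) (C := Real.log (C + 1) + τ₀ * A) hσ hτ
    (by norm_num) fun s hs ε hε => ?_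
  have hs1 : (1 : ℝ) ≤ s := Nat.one_le_cast.mpr hs
  have he1 : 1 ≤ ε⁻¹ := (one_le_inv₀ hε.1).mpr hε.2.le
  have hle := Real.log_nonneg he1
  have hlogs : (1 + Real.log s) * (1 + Real.log ε⁻¹)
      ≤ A * ((s : ℝ) ^ (σ * (1 / 2)) + ε ^ (-τ * (1 / 2))) := by
    convert one_add_log_mul_one_add_log_le hs1 he1 (p := σ / 4) (q := τ / 4) (by linarith)
      (by linarith) using 3
    · ring_nf
    · rw [Real.inv_rpow hε.1.le, ← Real.rpow_neg hε.1.le]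
      ring_nf
  have hone : 1 ≤ (s : ℝ) ^ (σ * (1 / 2)) + ε ^ (-τ * (1 / 2)) :=
    le_add_of_le_of_nonneg (Real.one_le_rpow hs1 (by linarith)) (Real.rpow_nonneg hε.1.le _)
  calc Real.log (n ε s)
      ≤ Real.log (C + 1) + τ₀ * ((1 + Real.log s) * (1 + Real.log ε⁻¹)) := by
        refine log_natCast_le_of_le_exp (by positivity) ((h s hs ε hε).trans ?_)
        rw [Real.exp_add, Real.exp_log (by linarith), ← mul_assoc τ₀]
        gcongr
        linarith
    _ ≤ Real.log (C + 1) * ((s : ℝ) ^ (σ * (1 / 2)) + ε ^ (-τ * (1 / 2)))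
          + τ₀ * (A * ((s : ℝ) ^ (σ * (1 / 2)) + ε ^ (-τ * (1 / 2)))) := by
        gcongr
        exact le_mul_of_one_le_right hlogC hone
    _ = (Real.log (C + 1) + τ₀ * A) * ((s : ℝ) ^ (σ * (1 / 2)) + ε ^ (-τ * (1 / 2))) := by ring

theorem UWT.wt (h : UWT n) : WT n := by
  simpa only [WT, WeakTractability, Real.rpow_one, Real.rpow_neg_one] using
    h 1 ⟨one_pos, le_rfl⟩ 1 ⟨one_pos, le_rfl⟩

end Weak

section Anova

variable {α : ℝ} [hα : Fact (1 ≤ α)] {γ : ProductWeights}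

theorem two_pow_le_anovaComplexity (hγ : ∀ j, γ j = 1) (s : ℕ) :
    2 ^ s ≤ anovaComplexity α γ (1 / 2) s := by
  simpa using card_subsets_le_anovaComplexity (α := α) γ s (ε := 1 / 2) (by norm_num)
    Finset.univ fun A _ => by
      simp only [hγ, Finset.prod_const_one]
      norm_num

theorem weightInf_lt_one_of_wt (h : WT (anovaComplexity α γ)) : weightInf γ < 1 := by
  by_contra! hle
  have hγ (j : ℕ) : γ j = 1 := (γ.le_one j).antisymm (hle.trans (weightInf_le γ j))
  have hlog : 0 < Real.log 2 := Real.log_pos one_lt_two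
  have hlim := h.comp (tendsto_prodMk_limitFilter (ε := 1 / 2) (by norm_num))
  obtain ⟨s, hs, hs2⟩ := ((hlim.eventually (gt_mem_nhds (half_pos hlog))).and
    (eventually_ge_atTop 2)).exists
  have hs2' : (2 : ℝ) ≤ s := by exact_mod_cast hs2
  refine hs.not_ge ((le_div_iff₀ (by positivity)).mpr ?_)
  calc Real.log 2 / 2 * (s + (1 / 2 : ℝ)⁻¹) ≤ s * Real.log 2 := by nlinarith
    _ = Real.log (2 ^ s : ℕ) := by rw [Nat.cast_pow, Real.log_pow, Nat.cast_ofNat]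
    _ ≤ Real.log (anovaComplexity α γ (1 / 2) s) :=
        Real.log_le_log (by positivity) (Nat.cast_le.mpr (two_pow_le_anovaComplexity hγ s))

theorem log_anovaComplexity_le (γ : ProductWeights) (s : ℕ) {ε : ℝ}
    (hε : ε ∈ Set.Ioo (0 : ℝ) 1) :
    Real.log (anovaComplexity α γ ε s) ≤ anovaZeta α 2 * s + 4 * Real.log ε⁻¹ := by
  have hκ : 1 / α < 2 := ((div_le_one (by linarith [hα.out])).mpr hα.out).trans_lt one_lt_two
  have hζ := anovaZeta_nonneg α 2
  have hsum : ∑ j ∈ Finset.range s, γ j ^ (2 : ℝ) ≤ s := by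
    simpa using Finset.sum_le_card_nsmul (Finset.range s) (fun j => γ j ^ (2 : ℝ)) 1
      fun j _ => Real.rpow_le_one (γ.pos j).le (γ.le_one j) zero_le_two
  have hle := Real.log_nonneg ((one_le_inv₀ hε.1).mpr hε.2.le)
  refine log_natCast_le_of_le_exp (by positivity) ((anovaComplexity_le_exp γ s hε.1 hκ).trans ?_)
  have hε_pow : ε ^ (-(2 * 2) : ℝ) = Real.exp (4 * Real.log ε⁻¹) := by
    rw [Real.rpow_def_of_pos hε.1, Real.log_inv]
    ring_nf
  rw [hε_pow, Real.exp_add, mul_comm (anovaZeta α 2)]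
  gcongr

theorem weakTractability_of_one_lt {σ τ : ℝ} (hσ : 1 < σ) (hτ : 0 < τ) :
    WeakTractability (anovaComplexity α γ) σ τ := by
  have hσ0 : 0 < σ := by linarith
  have hθ : 1 / σ ∈ Set.Ioo (0 : ℝ) 1 := ⟨by positivity, (div_lt_one hσ0).mpr hσ⟩
  refine weakTractability_of_log_le (C := anovaZeta α 2 + 4 / (τ * (1 / σ))) hσ0 hτ hθ
    fun s hs ε hε => ?_
  have hε0 := hε.1
  have hζ := anovaZeta_nonneg α 2
  have hlogε : Real.log ε⁻¹ ≤ ε ^ (-τ * (1 / σ)) / (τ * (1 / σ)) := by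
    rw [neg_mul, Real.rpow_neg hε0.le, ← Real.inv_rpow hε0.le]
    exact Real.log_le_rpow_div (by positivity) (by positivity)
  calc Real.log (anovaComplexity α γ ε s)
      ≤ anovaZeta α 2 * s + 4 * (ε ^ (-τ * (1 / σ)) / (τ * (1 / σ))) :=
        (log_anovaComplexity_le γ s hε).trans (by gcongr)
    _ ≤ anovaZeta α 2 * ((s : ℝ) + ε ^ (-τ * (1 / σ)))
          + 4 / (τ * (1 / σ)) * ((s : ℝ) + ε ^ (-τ * (1 / σ))) := by
        rw [← mul_div_assoc, mul_div_right_comm]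
        gcongr
        · exact le_add_of_nonneg_right (by positivity)
        · exact le_add_of_nonneg_left (by positivity)
    _ = (anovaZeta α 2 + 4 / (τ * (1 / σ)))
          * ((s : ℝ) ^ (σ * (1 / σ)) + ε ^ (-τ * (1 / σ))) := by
        rw [mul_one_div_cancel hσ0.ne', Real.rpow_one, add_mul]

end Anova

/-! ### Tractability and the weights -/

theorem SPT.pt {n : ℝ → ℕ → ℕ} (h : SPT n) : PT n := by
  obtain ⟨τ, C, hτ, hC, h⟩ := h
  exact ⟨τ, 0, C, hτ, le_rfl, hC, fun s hs ε hε => by simpa using h s hs ε hε⟩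

theorem sInf_nonneg_eq_two_mul {P : ℝ → Prop} {M : ℝ} (hM : 0 ≤ M)
    (hP : ∀ κ, M < κ → P (2 * κ)) (hlow : ∀ τ, 0 ≤ τ → P τ → M ≤ τ / 2) :
    sInf {τ | 0 ≤ τ ∧ P τ} = 2 * M := by
  refine csInf_eq_of_forall_ge_of_forall_gt_exists_lt
    ⟨2 * (M + 1), by positivity, hP _ (by linarith)⟩ ?_ fun w hw => ?_
  · rintro τ ⟨hτ, h⟩
    linarith [hlow τ hτ h]
  · obtain ⟨κ, hMκ, hκw⟩ := exists_between (show M < w / 2 by linarith)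
    exact ⟨2 * κ, ⟨by linarith, hP κ hMκ⟩, by linarith⟩

section Anova

variable {α : ℝ} [hα : Fact (1 ≤ α)] {γ : ProductWeights} {κ τ : ℝ}

theorem sumExponent_le_of_anovaComplexity_le {C σ : ℝ} (hτ : 0 ≤ τ)
    (h : ∀ s : ℕ, 1 ≤ s → ∀ ε ∈ Set.Ioo (0 : ℝ) 1,
      (anovaComplexity α γ ε s : ℝ) ≤ C * ε ^ (-τ) * (s : ℝ) ^ σ) :
    sumExponent γ ≤ ENNReal.ofReal (τ / 2) := by
  refine ENNReal.le_of_forall_pos_le_add fun δ hδ _ => ?_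
  rw [← ENNReal.ofReal_coe_nnreal, ← ENNReal.ofReal_add (by linarith) δ.coe_nonneg]
  have hκ : τ / 2 < τ / 2 + δ := lt_add_of_pos_right _ hδ
  exact sumExponent_le (by linarith) (summable_weight_rpow_of_anovaComplexity_le h hκ)

theorem sumExponent_lt_top_of_pt (h : PT (anovaComplexity α γ)) : sumExponent γ < ⊤ := by
  obtain ⟨τ, σ, C, hτ, -, -, h⟩ := h
  exact (sumExponent_le_of_anovaComplexity_le hτ h).trans_lt ENNReal.ofReal_lt_top

theorem isSPTBound_of_max_lt (h : sumExponent γ < ⊤)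
    (hκ : max (1 / α) (sumExponent γ).toReal < κ) :
    IsSPTBound (anovaComplexity α γ) (2 * κ) :=
  isSPTBound_of_summable ((le_max_left _ _).trans_lt hκ)
    (summable_weight_rpow_of_sumExponent_lt
      ((ENNReal.lt_ofReal_iff_toReal_lt h.ne).mpr ((le_max_right _ _).trans_lt hκ)))

theorem IsSPTBound.max_le_half (h : IsSPTBound (anovaComplexity α γ) τ) (hτ : 0 ≤ τ) :
    max (1 / α) (sumExponent γ).toReal ≤ τ / 2 := by
  obtain ⟨C, -, h⟩ := h
  refine max_le (one_div_le_of_anovaComplexity_one_le (γ := γ) (h 1 le_rfl))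
    (ENNReal.toReal_le_of_le_ofReal (by linarith)
      (sumExponent_le_of_anovaComplexity_le (α := α) (C := C) (σ := 0) hτ fun s hs ε hε => ?_))
  simpa using h s hs ε hε

theorem spt_of_sumExponent_lt_top (h : sumExponent γ < ⊤) : SPT (anovaComplexity α γ) := by
  obtain ⟨κ, hκ⟩ := exists_gt (max (1 / α) (sumExponent γ).toReal)
  obtain ⟨C, hC, hb⟩ := isSPTBound_of_max_lt h hκ
  have hκ0 : 0 < κ := ENNReal.toReal_nonneg.trans_lt ((le_max_right _ _).trans_lt hκ)
  exact ⟨2 * κ, C, by positivity, hC.le, hb⟩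

theorem spt_iff_sumExponent_lt_top : SPT (anovaComplexity α γ) ↔ sumExponent γ < ⊤ :=
  ⟨fun h => sumExponent_lt_top_of_pt h.pt, spt_of_sumExponent_lt_top⟩

theorem sptExponent_eq (h : sumExponent γ < ⊤) :
    sptExponent (anovaComplexity α γ) = 2 * max (1 / α) (sumExponent γ).toReal :=
  sInf_nonneg_eq_two_mul (le_max_of_le_right ENNReal.toReal_nonneg)
    (fun _ hκ => isSPTBound_of_max_lt h hκ) fun _ hτ hb => IsSPTBound.max_le_half hb hτ

theorem qpt_of_weightInf_lt_one (h : weightInf γ < 1) : QPT (anovaComplexity α γ) := by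
  have hlim : Tendsto (fun κ : ℝ => Real.exp (-κ⁻¹)) atTop (𝓝 1) := by
    simpa using (tendsto_inv_atTop_zero (𝕜 := ℝ)).neg.rexp
  obtain ⟨κ, hκ, hακ⟩ :=
    ((hlim.eventually (lt_mem_nhds h)).and (eventually_gt_atTop (1 / α))).exists
  have hκ0 : 0 < κ := (one_div_pos.mpr (by linarith [hα.out])).trans hακ
  obtain ⟨C, hC, hb⟩ := isQPTBound_of_weightInf_lt hακ hκ
  exact ⟨2 * κ, C, by positivity, hC.le, hb⟩

theorem IsQPTBound.one_div_le_half (h : IsQPTBound (anovaComplexity α γ) τ) :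
    1 / α ≤ τ / 2 := by
  obtain ⟨C, -, h⟩ := h
  refine one_div_le_of_anovaComplexity_one_le (γ := γ) (C := C * Real.exp τ) fun ε hε => ?_
  rw [mul_assoc, ← exp_mul_one_add_log_inv hε.1]
  simpa using h 1 le_rfl ε hε

theorem qptExponent_eq_of_weightInf_eq_zero (h : weightInf γ = 0) :
    qptExponent (anovaComplexity α γ) = 2 * (1 / α) :=
  sInf_nonneg_eq_two_mul (one_div_nonneg.mpr (by linarith [hα.out]))
    (fun _ hκ => isQPTBound_of_weightInf_lt hκ (h ▸ Real.exp_pos _))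
    fun _ _ hb => IsQPTBound.one_div_le_half hb

theorem qptExponent_eq_of_weightInf_pos (h0 : 0 < weightInf γ) (h1 : weightInf γ < 1) :
    qptExponent (anovaComplexity α γ) = 2 * max (1 / α) (1 / Real.log (weightInf γ)⁻¹) := by
  have hlog : 0 < Real.log (weightInf γ)⁻¹ := Real.log_pos ((one_lt_inv₀ h0).mpr h1)
  refine sInf_nonneg_eq_two_mul (le_max_of_le_right (by positivity)) (fun κ hκ => ?_)
    fun τ _ hb => max_le (IsQPTBound.one_div_le_half hb)
      ((div_le_iff₀ hlog).mpr (IsQPTBound.one_le_mul_log hb h0))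
  obtain ⟨hακ, hκlog⟩ := max_lt_iff.mp hκ
  refine isQPTBound_of_weightInf_lt hακ ((Real.log_lt_iff_lt_exp h0).mp (lt_neg.mp ?_))
  rw [← Real.log_inv]
  exact inv_lt_of_inv_lt₀ hlog (one_div (Real.log _) ▸ hκlog)

theorem qptExponent_eq (h : weightInf γ < 1) :
    qptExponent (anovaComplexity α γ) = if weightInf γ = 0 then 2 * (1 / α)
      else 2 * max (1 / α) (1 / Real.log (weightInf γ)⁻¹) := by
  split_ifs with h0
  · exact qptExponent_eq_of_weightInf_eq_zero h0
  · exact qptExponent_eq_of_weightInf_pos ((weightInf_nonneg γ).lt_of_ne' h0) h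

end Anova

end HermiteTractability

theorem theorem4p1 (α : ℝ) [Fact (1 ≤ α)] (γ : ProductWeights) :
    -- the minimum in the definition of the information complexity exists
    (∀ s : ℕ, 1 ≤ s → ∀ ε ∈ Set.Ioo (0 : ℝ) 1,
      ∃ n : ℕ, minimalError (anovaWeight α γ s) n ≤ ENNReal.ofReal ε) ∧
    -- strong polynomial tractability and its exponent
    (SPT (anovaComplexity α γ) ↔ sumExponent γ < ⊤) ∧
    (sumExponent γ < ⊤ →
      sptExponent (anovaComplexity α γ) = 2 * max (1 / α) (sumExponent γ).toReal) ∧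
    -- polynomial tractability
    (SPT (anovaComplexity α γ) ↔ PT (anovaComplexity α γ)) ∧
    -- quasi-polynomial, uniform weak and weak tractability
    (QPT (anovaComplexity α γ) ↔ weightInf γ < 1) ∧
    (UWT (anovaComplexity α γ) ↔ weightInf γ < 1) ∧
    (WT (anovaComplexity α γ) ↔ weightInf γ < 1) ∧
    (weightInf γ < 1 →
      qptExponent (anovaComplexity α γ) =
        if weightInf γ = 0 then 2 * (1 / α)
        else 2 * max (1 / α) (1 / Real.log (weightInf γ)⁻¹)) ∧
    -- weak tractability with parameters `σ > 1` and `τ > 0`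
    (∀ σ τ : ℝ, 1 < σ → 0 < τ → WeakTractability (anovaComplexity α γ) σ τ) :=
  ⟨fun s _ _ hε => exists_minimalError_anovaWeight_le γ s hε.1,
    spt_iff_sumExponent_lt_top,
    sptExponent_eq,
    ⟨SPT.pt, fun h => spt_of_sumExponent_lt_top (sumExponent_lt_top_of_pt h)⟩,
    ⟨fun h => weightInf_lt_one_of_wt h.uwt.wt, qpt_of_weightInf_lt_one⟩,
    ⟨fun h => weightInf_lt_one_of_wt h.wt, fun h => (qpt_of_weightInf_lt_one h).uwt⟩,
    ⟨weightInf_lt_one_of_wt, fun h => (qpt_of_weightInf_lt_one h).uwt.wt⟩,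
    qptExponent_eq,
    fun _ _ => weakTractability_of_one_lt⟩
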